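/- Let $d\in\mathbb N$ and let $H(t,q,p):\mathbb R\times\mathbb R^d\times\mathbb R^{d*}\to\mathbb R$ be a $C^2$ Hamiltonian for which there are constants $m>0$ and $M$ with $$\|d^2H(t,\cdot,\cdot)(q,p)\|\le M,\qquad \partial^2_{pp}H(t,q,p)\ge m\,\mathrm{Id},\qquad \tfrac m2|p|^2-M\le H(t,q,p)\le \tfrac M2|p|^2+M$$ for all $(t,q,p)$. The orbits of $H$ are the curves $(q(s),p(s))$, $s\in\mathbb R$, with $\dot q=\partial_pH(s,q,p)$, $\dot p=-\partial_qH(s,q,p)$. Call $\sigma>0$ a twist time if, for all $\tau<t\le\tau+\sigma$ and all $q_0,q_1\in\mathbb R^d$, there is exactly one orbit with $q(\tau)=q_0$ and $q(t)=q_1$; then $S_\tau^t(q_0,q_1)$ denotes its action $\int_\tau^t p(s)\cdot\dot q(s)-H(s,q(s),p(s))\,ds$. For $\tau<t$ set $$A_\tau^t(q_0,q_1)=\inf_{\theta_1,\dots,\theta_{n-1}\in\mathbb R^d}\ \sum_{i=0}^{n-1}S_{s_i}^{s_{i+1}}(\theta_i,\theta_{i+1}),\qquad \theta_0=q_0,\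 \theta_n=q_1,\ s_i=\tau+\tfrac{i(t-\tau)}n,$$ where $n\ge1$ is any integer with $(t-\tau)/n<\sigma$ for some twist time $\sigma$, and, for $v:\mathbb R^d\to\mathbb R$, $$\mathbf T_\tau^tv(q)=\inf_{\theta\in\mathbb R^d}\big(v(\theta)+A_\tau^t(\theta,q)\big),\qquad \check{\mathbf T}_t^\tau v(q)=\sup_{\theta\in\mathbb R^d}\big(v(\theta)-A_\tau^t(q,\theta)\big),$$ while $\mathbf T_t^t$ and $\check{\mathbf T}_t^t$ are the identity. Then a twist time exists. Moreover, let $-\infty\le t_0<t_1\le+\infty$ and let $u:\,]t_0,t_1[\times\mathbb R^d\to\mathbb R$ be a $C^1$ solution of the Hamilton-Jacobi equation $$\partial_tu+H(t,q,\partial_qu(t,q))=0,$$ and write $u_t=u(t,\cdot)$. Then: 1. $\mathbf T_\tau^tu_\tau=u_t$ and $\check{\mathbf T}_t^\tau u_t=u_\tau$ for all $\tau\le t$ in $]t_0,t_1[$, whichever admissible $n$ is used in $A_\tau^t$. 2. $u$ is locally $C^{1,1}$ on $]t_0,t_1[\times\mathbb R^d$: it is differentiable with locally Lipschitz differential. 3.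 If $\tilde u$ is another $C^1$ solution on $]t_0,t_1[\times\mathbb R^d$ and $\tilde u_\tau=u_\tau$ for some $\tau\in\,]t_0,t_1[$, then $\tilde u=u$. -/

import Mathlib

noncomputable section

namespace HamiltonJacobi

/-- The space `ℝ^d`; its dual is identified with it through the Euclidean inner product, so that
partial differentials in `q` and `p` become gradients. -/
abbrev E (d : ℕ) : Type := EuclideanSpace ℝ (Fin d)

/-- The standing hypotheses on a Hamiltonian `H(t,q,p)`: it is `C²`, its second differential in
the phase variable `x = (q,p)` is bounded by `M`, it satisfies `∂²_pp H ≥ m Id` with `m > 0`, and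
it has quadratic growth in `p`. -/
structure IsConvexHamiltonian {d : ℕ} (H : ℝ → E d → E d → ℝ) (m M : ℝ) : Prop where
  contDiff : ContDiff ℝ 2 (fun z : ℝ × E d × E d => H z.1 z.2.1 z.2.2)
  hessian_bound : ∀ (t : ℝ) (x : E d × E d),
    ‖fderiv ℝ (fderiv ℝ (fun y : E d × E d => H t y.1 y.2)) x‖ ≤ M
  m_pos : 0 < m
  convex : ∀ (t : ℝ) (q p v : E d),
    m * ‖v‖ ^ 2 ≤ fderiv ℝ (fderiv ℝ (fun p' : E d => H t q p')) p v v
  growth_lower : ∀ (t : ℝ) (q p : E d), m / 2 * ‖p‖ ^ 2 - M ≤ H t q p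
  growth_upper : ∀ (t : ℝ) (q p : E d), H t q p ≤ M / 2 * ‖p‖ ^ 2 + M

/-- `x = (q,p) : ℝ → ℝ^d × ℝ^d` is an orbit of the Hamiltonian system
`q' = ∂_p H(t,q,p)`, `p' = -∂_q H(t,q,p)`. -/
def IsOrbit {d : ℕ} (H : ℝ → E d → E d → ℝ) (x : ℝ → E d × E d) : Prop :=
  ∀ t : ℝ, HasDerivAt x
    (gradient (fun p => H t (x t).1 p) (x t).2, -gradient (fun q => H t q (x t).2) (x t).1) t

/-- `x` is an orbit whose projection goes from `q₀` at time `τ` to `q₁` at time `t`. -/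
def IsJoiningOrbit {d : ℕ} (H : ℝ → E d → E d → ℝ) (τ t : ℝ) (q₀ q₁ : E d)
    (x : ℝ → E d × E d) : Prop :=
  IsOrbit H x ∧ (x τ).1 = q₀ ∧ (x t).1 = q₁

/-- The Hamiltonian action `∫_τ^t p · q' - H(s,q,p) ds` of the curve `x = (q,p)`. -/
def action {d : ℕ} (H : ℝ → E d → E d → ℝ) (τ t : ℝ) (x : ℝ → E d × E d) : ℝ :=
  ∫ s in τ..t, (inner ℝ (x s).2 (deriv (fun r => (x r).1) s) - H s (x s).1 (x s).2)

/-- `σ > 0` is a twist time if any two points of `ℝ^d` are joined by exactly one orbit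
on every time interval of positive length at most `σ`. -/
def IsTwistTime {d : ℕ} (H : ℝ → E d → E d → ℝ) (σ : ℝ) : Prop :=
  0 < σ ∧ ∀ τ t : ℝ, τ < t → t - τ ≤ σ → ∀ q₀ q₁ : E d, ∃! x, IsJoiningOrbit H τ t q₀ q₁ x

open Classical in
/-- The generating function `S_τ^t(q₀,q₁)`: the action of the orbit joining `q₀` to `q₁` between
the times `τ` and `t`. It is meaningful when `t - τ` is positive and at most a twist time, so that
the orbit exists and is unique; the value `0` is a default. -/
def genFun {d : ℕ} (H : ℝ → E d → E d → ℝ) (τ t : ℝ) (q₀ q₁ : E d) : ℝ :=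
  if h : ∃ x, IsJoiningOrbit H τ t q₀ q₁ x then action H τ t h.choose else 0

/-- The broken action of `θ₀, …, θ_n` along the subdivision of `[τ,t]` into `n` equal steps. -/
def brokenAction {d : ℕ} (H : ℝ → E d → E d → ℝ) (n : ℕ) (τ t : ℝ) (θ : Fin (n + 1) → E d) : ℝ :=
  ∑ i : Fin n, genFun H (τ + (i : ℝ) * ((t - τ) / n)) (τ + ((i : ℝ) + 1) * ((t - τ) / n))
    (θ i.castSucc) (θ i.succ)

/-- The minimal action `A_τ^t(q₀,q₁)`, computed with `n` equal steps, as the infimum (in the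
extended reals) of the broken actions from `q₀` to `q₁`. It is used when `(t - τ) / n` is smaller
than a twist time. -/
def minAction {d : ℕ} (H : ℝ → E d → E d → ℝ) (n : ℕ) (τ t : ℝ) (q₀ q₁ : E d) : EReal :=
  ⨅ θ : {θ : Fin (n + 1) → E d // θ 0 = q₀ ∧ θ (Fin.last n) = q₁},
    ((brokenAction H n τ t θ.1 : ℝ) : EReal)

/-- The Lax-Oleinik operator `T_τ^t`, the identity when `τ = t`. -/
def laxOleinik {d : ℕ} (H : ℝ → E d → E d → ℝ) (n : ℕ) (τ t : ℝ) (v : E d → ℝ) (q : E d) : EReal :=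
  if τ = t then (v q : EReal) else ⨅ θ : E d, ((v θ : EReal) + minAction H n τ t θ q)

/-- The dual Lax-Oleinik operator `Ť_t^τ`, from time `t` back to time `τ ≤ t`; the identity when
`τ = t`. -/
def dualLaxOleinik {d : ℕ} (H : ℝ → E d → E d → ℝ) (n : ℕ) (τ t : ℝ) (v : E d → ℝ) (q : E d) :
    EReal :=
  if τ = t then (v q : EReal) else ⨆ θ : E d, ((v θ : EReal) - minAction H n τ t q θ)

/-- The open time interval `]t₀,t₁[`, whose ends may be infinite. -/
def timeInterval (t₀ t₁ : EReal) : Set ℝ := {t : ℝ | t₀ < (t : EReal) ∧ (t : EReal) < t₁}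

/-- `u` is a `C¹` solution of `∂_t u + H(t,q,∂_q u) = 0` on `]t₀,t₁[ × ℝ^d`. -/
def IsC1Solution {d : ℕ} (H : ℝ → E d → E d → ℝ) (t₀ t₁ : EReal) (u : ℝ → E d → ℝ) : Prop :=
  ContDiffOn ℝ 1 (fun z : ℝ × E d => u z.1 z.2) (timeInterval t₀ t₁ ×ˢ Set.univ) ∧
  ∀ t ∈ timeInterval t₀ t₁, ∀ q : E d,
    deriv (fun s => u s q) t + H t q (gradient (u t) q) = 0

/-- `f` is locally `C^{1,1}` on the (open) set `Ω`: it is differentiable there, with a locally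
Lipschitz differential. -/
def IsLocallyC11On {d : ℕ} (f : ℝ × E d → ℝ) (Ω : Set (ℝ × E d)) : Prop :=
  DifferentiableOn ℝ f Ω ∧ LocallyLipschitzOn Ω (fderiv ℝ f)

end HamiltonJacobi

end

/-! A `C¹` solution calibrates the action. By the Fenchel inequality
(`IsConvexHamiltonian.rate_le`), the increment of `u` along any orbit is at most the action, with
equality if the orbit lies in the graph of `∂_q u`. If every point of that graph lies on an orbit
that stays in it over the whole time interval, then the broken actions sampled along this orbit
attain the bounds in both Lax-Oleinik formulas. This gives 1. Then 3 follows, since `u_τ` determines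
`u_t` forwards and backwards.

The crux is the invariance of the graph (`graph_invariant`), because `u` cannot be differentiated
twice. The field `∂_pH(s,q,∂_q u)` is only continuous, so Peano's theorem provides a curve `c` with
this velocity. Perturbing `c` by `εη` with fixed ends leaves the increment of `u` unchanged, while
`IsConvexHamiltonian.rate_add_le` bounds the perturbed rate by a first-order expansion plus `O(ε²)`,
whatever the gradient of `u` is at the displaced point. The linear term therefore vanishes, and the
du Bois-Reymond lemma gives `p' = -∂_qH` for `p = ∂_q u(s,c)`. The lift of `c` is thus an orbit;
uniqueness of orbits and a connectedness argument conclude.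

The same estimate with one free end bounds `u_t` from above and below by its first-order expansion
up to a quadratic error, so `∂_q u` is Lipschitz in space. Following orbits gives the dependence on
time, and the equation then controls `∂_t u`.

A twist time exists because over a short time the final position is a strongly monotone Lipschitz
function of the initial momentum, hence a bijection. -/

open Set Filter Topology MeasureTheory
open scoped NNReal Manifold RealInnerProductSpace

/-! ### Global Cauchy-Lipschitz and Peano existence theorems. -/

section ODE

variable {F : Type*} [NormedAddCommGroup F] [NormedSpace ℝ F]

/-- A `C¹` time-dependent vector field which is Lipschitz in space, uniformly in time, has
global solutions. -/
theorem exists_forall_hasDerivAt_of_lipschitzWith [CompleteSpace F] {v : ℝ → F → F} {K : ℝ≥0}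
    (hv : ContDiff ℝ 1 (fun z : ℝ × F => v z.1 z.2)) (hK : ∀ t, LipschitzWith K (v t))
    (t₀ : ℝ) (x₀ : F) : ∃ x : ℝ → F, x t₀ = x₀ ∧ ∀ t, HasDerivAt x (v t (x t)) t := by
  -- Time is added as a coordinate, to make the field autonomous: local integral curves whose
  -- duration `h` does not depend on the starting point then extend to a global one.
  set w : ℝ × F → ℝ × F := fun z => (1, v z.1 z.2) with hw
  have hwC : ContDiff ℝ 1 w := contDiff_const.prodMk hv
  have hpos : (0 : ℝ) < 2 * (K + 1) := by positivity
  set h : ℝ := 1 / (2 * (K + 1)) with hh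
  have h0 : 0 < h := by positivity
  have key : ∀ z : ℝ × F, ∃ γ : ℝ → ℝ × F, γ 0 = z ∧
      IsMIntegralCurveOn (I := 𝓘(ℝ, ℝ × F)) γ w (Ioo (-h) h) := by
    rintro ⟨s, y⟩
    have hc : ContinuousOn (fun t => v t y) (Icc (s - h) (s + h)) :=
      (hv.continuous.comp (by fun_prop : Continuous fun t : ℝ => (t, y))).continuousOn
    obtain ⟨C, hC⟩ := isCompact_Icc.exists_bound_of_continuousOn hc
    set L₀ : ℝ≥0 := C.toNNReal
    have hL₀ : ∀ t ∈ Icc (s - h) (s + h), ‖v t y‖ ≤ L₀ := fun t ht =>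
      (hC t ht).trans (Real.le_coe_toNNReal C)
    have hs : s ∈ Icc (s - h) (s + h) := ⟨by linarith, by linarith⟩
    -- The radius `L₀` of the ball is the bound on the speed at its centre, so the speed in the ball
    -- is at most `(1 + K) L₀` and a time `h = 1 / (2(K + 1))` never leads out of it, whatever `L₀`
    -- is.
    have hPL : IsPicardLindelof v (⟨s, hs⟩ : Icc (s - h) (s + h)) y L₀ 0 (L₀ + K * L₀) K := by
      refine ⟨fun t _ => (hK t).lipschitzOnWith, fun x _ => ?_, fun t ht x hx => ?_, ?_⟩
      · exact (hv.continuous.comp (by fun_prop : Continuous fun t : ℝ => (t, x))).continuousOn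
      · have h1 : ‖v t x - v t y‖ ≤ K * L₀ := by
          rw [← dist_eq_norm]
          exact ((hK t).dist_le_mul x y).trans
            (mul_le_mul_of_nonneg_left (Metric.mem_closedBall.1 hx) K.2)
        calc ‖v t x‖ = ‖v t y + (v t x - v t y)‖ := by simp
          _ ≤ ‖v t y‖ + ‖v t x - v t y‖ := norm_add_le _ _
          _ ≤ _ := by push_cast; exact add_le_add (hL₀ t ht) h1
      · have : max (s + h - s) (s - (s - h)) = h := by simp
        push_cast
        rw [this, hh, mul_one_div, div_le_iff₀ hpos]
        nlinarith [L₀.2, K.2, mul_nonneg L₀.2 K.2]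
    obtain ⟨α, hα0, hα⟩ := hPL.exists_eq_forall_mem_Icc_hasDerivWithinAt₀
    refine ⟨fun r => (s + r, α (s + r)), by simpa using hα0, fun r hr => ?_⟩
    have hd : HasDerivAt α (v (s + r) (α (s + r))) (s + r) :=
      (hα (s + r) ⟨by linarith [hr.1], by linarith [hr.2]⟩).hasDerivAt
        (Icc_mem_nhds (by linarith [hr.1]) (by linarith [hr.2]))
    have hd1 : HasDerivAt (fun r : ℝ => s + r) 1 r := by simpa using (hasDerivAt_id r).const_add s
    have hd2 := hd1.prodMk (hd.scomp r hd1)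
    rw [one_smul] at hd2
    exact hd2.hasFDerivAt.hasMFDerivAt.hasMFDerivWithinAt
  obtain ⟨γ, hγ0, hγ⟩ := exists_isMIntegralCurve_of_isMIntegralCurveOn (I := 𝓘(ℝ, ℝ × F))
    (v := w) (contMDiff_vectorSpace_iff_contDiff.2 hwC) h0 key (t₀, x₀)
  have hγ' : ∀ r, HasDerivAt γ (w (γ r)) r := fun r => by
    have h1 : HasFDerivAt γ ((1 : ℝ →L[ℝ] ℝ).smulRight (w (γ r))) r := (hγ r).hasFDerivAt
    simpa using h1.hasDerivAt
  have hfst : ∀ r, HasDerivAt (fun r => (γ r).1) 1 r := fun r => (hγ' r).fst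
  have hsnd : ∀ r, HasDerivAt (fun r => (γ r).2) (v (γ r).1 (γ r).2) r := fun r => (hγ' r).snd
  have htime : ∀ r, (γ r).1 = t₀ + r := by
    have hz : ∀ r, HasDerivAt (fun r => (γ r).1 - r) 0 r := fun r => by
      simpa using (hfst r).fun_sub (hasDerivAt_id r)
    intro r
    have := is_const_of_deriv_eq_zero (fun r => (hz r).differentiableAt)
      (fun r => (hz r).deriv) r 0
    simp only [hγ0] at this
    linarith
  refine ⟨fun t => (γ (t - t₀)).2, by simp [hγ0], fun t => ?_⟩
  have hd1 : HasDerivAt (fun t : ℝ => t - t₀) 1 t := by simpa using (hasDerivAt_id t).sub_const t₀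
  have := (hsnd (t - t₀)).scomp t hd1
  rw [one_smul, htime] at this
  simpa [Function.comp_def] using this

variable [FiniteDimensional ℝ F]

/-- **Peano existence theorem** for a continuous time-dependent vector field with compact
support. -/
theorem exists_forall_hasDerivAt_of_hasCompactSupport {g : ℝ × F → F} (hg : Continuous g)
    (hsupp : HasCompactSupport g) (t₀ : ℝ) (x₀ : F) :
    ∃ x : ℝ → F, x t₀ = x₀ ∧ ∀ t, HasDerivAt x (g (t, x t)) t := by
  obtain ⟨C, hC⟩ := hg.bounded_above_of_compact_support hsupp
  have hC0 : 0 ≤ C := (norm_nonneg _).trans (hC 0)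
  have happ : ∀ k : ℕ, ∃ y : ℝ → F, ∃ y' : ℝ → F, y t₀ = x₀ ∧ (∀ t, HasDerivAt y (y' t) t) ∧
      ∀ t, ‖y' t - g (t, y t)‖ ≤ 1 / ((k : ℝ) + 1) := by
    intro k
    obtain ⟨G, hG1, hG2, hG3⟩ := hg.exists_contDiff_approx 1 (ε := fun _ => 1 / ((k : ℝ) + 1))
      continuous_const (fun _ => by positivity)
    obtain ⟨K, hK⟩ := ContDiff.lipschitzWith_of_hasCompactSupport (𝕂 := ℝ)
      (hsupp.mono hG3) hG1 (by simp)
    obtain ⟨y, hy0, hy⟩ := exists_forall_hasDerivAt_of_lipschitzWith (v := fun t x => G (t, x))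
      (K := K) hG1 (fun t => by
        simpa [Function.comp_def] using hK.comp (LipschitzWith.prodMk_left t)) t₀ x₀
    refine ⟨y, fun t => G (t, y t), hy0, hy, fun t => ?_⟩
    rw [← dist_eq_norm]
    exact (hG2 _).le
  choose y y' hy0 hy hyg using happ
  have hk1 : ∀ k : ℕ, 1 / ((k : ℝ) + 1) ≤ 1 := fun k => by
    rw [div_le_one (by positivity)]; linarith [k.cast_nonneg (α := ℝ)]
  have hlip : ∀ k s r, ‖y k r - y k s‖ ≤ (C + 1) * ‖r - s‖ := fun k s r =>
    convex_univ.norm_image_sub_le_of_norm_hasDerivWithin_le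
      (fun t _ => (hy k t).hasDerivWithinAt)
      (fun t _ => by
        calc ‖y' k t‖ = ‖g (t, y k t) + (y' k t - g (t, y k t))‖ := by simp
          _ ≤ _ := norm_add_le _ _
          _ ≤ C + 1 := add_le_add (hC _) ((hyg k t).trans (hk1 k))) (mem_univ _) (mem_univ _)
  -- The smooth approximate solutions are equi-Lipschitz. Pointwise limits along a non-principal
  -- ultrafilter replace the extraction of a subsequence by Arzelà-Ascoli.
  have hlim : ∀ s, ∃ z, Tendsto (fun k => y k s) (hyperfilter ℕ : Filter ℕ) (𝓝 z) := by
    intro s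
    obtain ⟨z, -, hz⟩ := (isCompact_closedBall x₀ ((C + 1) * ‖s - t₀‖)).ultrafilter_le_nhds
      ((hyperfilter ℕ).map fun k => y k s) (by
        rw [le_principal_iff]
        have hmem : ∀ᶠ k in (hyperfilter ℕ : Filter ℕ),
            y k s ∈ Metric.closedBall x₀ ((C + 1) * ‖s - t₀‖) :=
          Eventually.of_forall fun k => by simpa [dist_eq_norm, hy0] using hlip k t₀ s
        exact hmem)
    exact ⟨z, hz⟩
  choose x hx using hlim
  have hk0 : Tendsto (fun k : ℕ => 1 / ((k : ℝ) + 1)) (hyperfilter ℕ : Filter ℕ) (𝓝 0) :=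
    tendsto_one_div_add_atTop_nhds_zero_nat.mono_left Nat.hyperfilter_le_atTop
  refine ⟨x, tendsto_nhds_unique (hx t₀) (by simp [hy0]), fun s => ?_⟩
  rw [hasDerivAt_iff_isLittleO, Asymptotics.isLittleO_iff]
  intro ε hε
  obtain ⟨δ, hδ, hgδ⟩ := Metric.uniformContinuous_iff.1
    (hsupp.uniformContinuous_of_continuous hg) ε hε
  -- Within this time, `y k` moves by less than `δ`, as its speed is at most `C + 1`; so `g` varies
  -- by less than `ε` along it. The resulting bound is uniform in `k` and passes to the limit.
  have hδ' : 0 < δ / (C + 2) := by positivity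
  filter_upwards [Metric.ball_mem_nhds s hδ'] with r hr
  have hbound : ∀ k, ‖y k r - y k s - (r - s) • g (s, y k s)‖ ≤
      (1 / ((k : ℝ) + 1) + ε) * ‖r - s‖ := by
    intro k
    have := (convex_ball s (δ / (C + 2))).norm_image_sub_le_of_norm_hasDerivWithin_le
      (f := fun r => y k r - r • g (s, y k s)) (f' := fun r => y' k r - g (s, y k s))
      (C := 1 / ((k : ℝ) + 1) + ε) (x := s) (y := r)
      (fun t _ => by
        simpa using
          ((hy k t).fun_sub ((hasDerivAt_id t).smul_const (g (s, y k s)))).hasDerivWithinAt)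
      (fun t ht => by
        have hts : ‖t - s‖ < δ / (C + 2) := by simpa [dist_eq_norm] using ht
        rw [lt_div_iff₀ (by positivity)] at hts
        have hd : dist (t, y k t) (s, y k s) < δ := by
          rw [Prod.dist_eq, max_lt_iff, dist_eq_norm, dist_eq_norm]
          have h1 := hlip k s t
          have h2 := norm_nonneg (t - s)
          constructor <;> nlinarith
        have h3 := hgδ hd
        rw [dist_eq_norm] at h3
        calc ‖y' k t - g (s, y k s)‖
            = ‖(y' k t - g (t, y k t)) + (g (t, y k t) - g (s, y k s))‖ := by simp
          _ ≤ _ := norm_add_le _ _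
          _ ≤ _ := add_le_add (hyg k t) h3.le)
      (Metric.mem_ball_self hδ') hr
    convert this using 2
    module
  have h1 : Tendsto (fun k => ‖y k r - y k s - (r - s) • g (s, y k s)‖)
      (hyperfilter ℕ : Filter ℕ) (𝓝 ‖x r - x s - (r - s) • g (s, x s)‖) :=
    (((hx r).sub (hx s)).sub (((hg.tendsto (s, x s)).comp
      (tendsto_const_nhds.prodMk_nhds (hx s))).const_smul (r - s))).norm
  have h2 : Tendsto (fun k : ℕ => (1 / ((k : ℝ) + 1) + ε) * ‖r - s‖)
      (hyperfilter ℕ : Filter ℕ) (𝓝 ((0 + ε) * ‖r - s‖)) := (hk0.add_const ε).mul_const _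
  simpa using le_of_tendsto_of_tendsto' h1 h2 hbound

/-- **Peano existence theorem**, local form. -/
theorem exists_eventually_hasDerivAt_of_continuousOn {f : ℝ × F → F} {U : Set (ℝ × F)}
    (hU : IsOpen U) (hf : ContinuousOn f U) {t₀ : ℝ} {x₀ : F} (h₀ : (t₀, x₀) ∈ U) :
    ∃ x : ℝ → F, x t₀ = x₀ ∧ ∀ᶠ t in 𝓝 t₀, (t, x t) ∈ U ∧ HasDerivAt x (f (t, x t)) t := by
  obtain ⟨r, hr, hrU⟩ := Metric.isOpen_iff.1 hU _ h₀
  let φ : ContDiffBump ((t₀, x₀) : ℝ × F) := ⟨r / 4, r / 2, by positivity, by linarith⟩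
  have hts : tsupport φ ⊆ U := by
    rw [φ.tsupport_eq]
    exact (Metric.closedBall_subset_ball (by simp [φ]; linarith)).trans hrU
  have hsub : tsupport (fun z => φ z • f z) ⊆ tsupport φ := tsupport_smul_subset_left _ _
  have hcont : Continuous (fun z => φ z • f z) :=
    (φ.continuous.continuousOn.smul hf).continuous_of_tsupport_subset hU (hsub.trans hts)
  have hcomp : HasCompactSupport (fun z => φ z • f z) := φ.hasCompactSupport.smul_right
  obtain ⟨x, hx0, hx⟩ := exists_forall_hasDerivAt_of_hasCompactSupport hcont hcomp t₀ x₀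
  refine ⟨x, hx0, ?_⟩
  have hc : Tendsto (fun t => (t, x t)) (𝓝 t₀) (𝓝 (t₀, x₀)) := by
    have := (continuousAt_id (x := t₀)).prodMk (hx t₀).continuousAt
    simpa [ContinuousAt, hx0] using this
  filter_upwards [hc.eventually φ.eventuallyEq_one, hc.eventually (hU.mem_nhds h₀)] with t h1 h2
  refine ⟨h2, ?_⟩
  have := hx t
  simp only [h1, Pi.one_apply, one_smul] at this
  exact this

end ODE

/-! ### Gradients of the Hamiltonian and the Hamiltonian flow. -/

namespace HamiltonJacobi

variable {d : ℕ} {H : ℝ → E d → E d → ℝ} {m M : ℝ} {t₀ t₁ : EReal} {u : ℝ → E d → ℝ}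

theorem norm_le_of_forall_inner_le {a : E d} {C : ℝ} (hC : 0 ≤ C) (h : ∀ v, ⟪a, v⟫ ≤ C * ‖v‖) :
    ‖a‖ ≤ C := by
  rcases (norm_nonneg a).eq_or_lt with h0 | h0
  · rwa [← h0]
  · have := h a
    rw [real_inner_self_eq_norm_mul_norm] at this
    exact le_of_mul_le_mul_right this h0

theorem inner_gradient {f : E d → ℝ} {x : E d} (v : E d) : ⟪gradient f x, v⟫ = fderiv ℝ f x v := by
  simp [gradient]

/-- The gradient `∂_p H` at the point `x = (q, p)` of the phase space. -/
noncomputable def gradP (H : ℝ → E d → E d → ℝ) (t : ℝ) (x : E d × E d) : E d :=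
  gradient (fun p => H t x.1 p) x.2

/-- The gradient `∂_q H` at the point `x = (q, p)` of the phase space. -/
noncomputable def gradQ (H : ℝ → E d → E d → ℝ) (t : ℝ) (x : E d × E d) : E d :=
  gradient (fun q => H t q x.2) x.1

/-- The Hamiltonian vector field. -/
noncomputable def vecField (H : ℝ → E d → E d → ℝ) (t : ℝ) (x : E d × E d) : E d × E d :=
  (gradP H t x, -gradQ H t x)

theorem IsOrbit.hasDerivAt_fst {x : ℝ → E d × E d} (hx : IsOrbit H x) (s : ℝ) :
    HasDerivAt (fun s => (x s).1) (gradP H s (x s)) s :=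
  (ContinuousLinearMap.fst ℝ (E d) (E d)).hasFDerivAt.comp_hasDerivAt s (hx s)

theorem IsOrbit.hasDerivAt_snd {x : ℝ → E d × E d} (hx : IsOrbit H x) (s : ℝ) :
    HasDerivAt (fun s => (x s).2) (-gradQ H s (x s)) s :=
  (ContinuousLinearMap.snd ℝ (E d) (E d)).hasFDerivAt.comp_hasDerivAt s (hx s)

theorem IsOrbit.continuous {x : ℝ → E d × E d} (hx : IsOrbit H x) : Continuous x :=
  continuous_iff_continuousAt.2 fun s => (hx s).continuousAt

namespace IsConvexHamiltonian

variable (hH : IsConvexHamiltonian H m M)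
include hH

theorem M_nonneg : 0 ≤ M :=
  le_trans (norm_nonneg (fderiv ℝ (fderiv ℝ (fun y : E d × E d => H 0 y.1 y.2)) 0))
    (hH.hessian_bound 0 0)

theorem contDiff_phase (t : ℝ) : ContDiff ℝ 2 (fun y : E d × E d => H t y.1 y.2) :=
  hH.contDiff.comp (contDiff_prodMk_right t)

theorem contDiff_momentum (t : ℝ) (q : E d) : ContDiff ℝ 2 (fun p => H t q p) :=
  (hH.contDiff_phase t).comp (contDiff_prodMk_right q)

theorem contDiff_position (t : ℝ) (p : E d) : ContDiff ℝ 2 (fun q => H t q p) :=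
  (hH.contDiff_phase t).comp (contDiff_prodMk_left p)

theorem inner_gradP (t : ℝ) (x : E d × E d) (v : E d) :
    ⟪gradP H t x, v⟫ = fderiv ℝ (fun y : E d × E d => H t y.1 y.2) x (0, v) := by
  rw [gradP, inner_gradient]
  have h1 := ((hH.contDiff_phase t).differentiable (by norm_num) (x.1, x.2)).hasFDerivAt
  have h2 := h1.comp x.2 (hasFDerivAt_prodMk_right x.1 x.2)
  rw [show (fun p => H t x.1 p) = (fun y : E d × E d => H t y.1 y.2) ∘ fun p => (x.1, p) from rfl,
    h2.fderiv]
  simp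

theorem inner_gradQ (t : ℝ) (x : E d × E d) (v : E d) :
    ⟪gradQ H t x, v⟫ = fderiv ℝ (fun y : E d × E d => H t y.1 y.2) x (v, 0) := by
  rw [gradQ, inner_gradient]
  have h1 := ((hH.contDiff_phase t).differentiable (by norm_num) (x.1, x.2)).hasFDerivAt
  have h2 := HasFDerivAt.comp (f := fun q => (q, x.2)) x.1 h1 (hasFDerivAt_prodMk_left x.1 x.2)
  rw [show (fun q => H t q x.2) = (fun y : E d × E d => H t y.1 y.2) ∘ fun q => (q, x.2) from rfl,
    h2.fderiv]
  simp

theorem fderiv_phase (t : ℝ) (x w : E d × E d) :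
    fderiv ℝ (fun y : E d × E d => H t y.1 y.2) x w =
      fderiv ℝ (fun z : ℝ × E d × E d => H z.1 z.2.1 z.2.2) (t, x) (0, w) := by
  have h1 := (hH.contDiff.differentiable (by norm_num) (t, x)).hasFDerivAt
  have h2 := h1.comp x (hasFDerivAt_prodMk_right t x)
  rw [show (fun y : E d × E d => H t y.1 y.2) =
    (fun z : ℝ × E d × E d => H z.1 z.2.1 z.2.2) ∘ fun y => (t, y) from rfl, h2.fderiv]
  simp

theorem contDiff_fderiv_apply (w : ℝ × E d × E d) : ContDiff ℝ 1 (fun z : ℝ × E d × E d =>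
    fderiv ℝ (fun z : ℝ × E d × E d => H z.1 z.2.1 z.2.2) z w) :=
  (hH.contDiff.fderiv_right (m := 1) (by norm_num)).clm_apply contDiff_const

theorem contDiff_gradP : ContDiff ℝ 1 (fun z : ℝ × E d × E d => gradP H z.1 z.2) := by
  rw [contDiff_euclidean]
  intro i
  have h : (fun z : ℝ × E d × E d => gradP H z.1 z.2 i) = fun z =>
      fderiv ℝ (fun z : ℝ × E d × E d => H z.1 z.2.1 z.2.2) z
        (0, 0, EuclideanSpace.single i 1) := by
    funext z
    rw [← hH.fderiv_phase z.1 z.2, ← hH.inner_gradP]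
    simp [EuclideanSpace.inner_single_right]
  rw [h]
  exact hH.contDiff_fderiv_apply _

theorem contDiff_gradQ : ContDiff ℝ 1 (fun z : ℝ × E d × E d => gradQ H z.1 z.2) := by
  rw [contDiff_euclidean]
  intro i
  have h : (fun z : ℝ × E d × E d => gradQ H z.1 z.2 i) = fun z =>
      fderiv ℝ (fun z : ℝ × E d × E d => H z.1 z.2.1 z.2.2) z
        (0, EuclideanSpace.single i 1, 0) := by
    funext z
    rw [← hH.fderiv_phase z.1 z.2, ← hH.inner_gradQ]
    simp [EuclideanSpace.inner_single_right]
  rw [h]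
  exact hH.contDiff_fderiv_apply _

theorem contDiff_vecField : ContDiff ℝ 1 (fun z : ℝ × E d × E d => vecField H z.1 z.2) :=
  hH.contDiff_gradP.prodMk hH.contDiff_gradQ.neg

/-- The mean value inequality turns the Hessian bound into the Lipschitz constant `M`, uniform in
time, from which global existence and uniqueness of orbits follow. -/
theorem norm_fderiv_phase_sub_le (t : ℝ) (x y : E d × E d) :
    ‖fderiv ℝ (fun y : E d × E d => H t y.1 y.2) x -
      fderiv ℝ (fun y : E d × E d => H t y.1 y.2) y‖ ≤ M * ‖x - y‖ :=
  convex_univ.norm_image_sub_le_of_norm_fderiv_le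
    (fun z _ => ((hH.contDiff_phase t).fderiv_right (m := 1) (by norm_num)).differentiable
      (by norm_num) z) (fun z _ => hH.hessian_bound t z) (mem_univ _) (mem_univ _)

theorem norm_gradP_sub_le (t : ℝ) (x y : E d × E d) :
    ‖gradP H t x - gradP H t y‖ ≤ M * ‖x - y‖ := by
  refine norm_le_of_forall_inner_le (mul_nonneg hH.M_nonneg (norm_nonneg _)) fun v => ?_
  rw [inner_sub_left, hH.inner_gradP, hH.inner_gradP, ← sub_apply]
  have : ‖((0 : E d), v)‖ = ‖v‖ := by simp [Prod.norm_def]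
  refine (Real.le_norm_self _).trans ((ContinuousLinearMap.le_opNorm _ _).trans ?_)
  rw [this]
  exact mul_le_mul_of_nonneg_right (hH.norm_fderiv_phase_sub_le t x y) (norm_nonneg _)

theorem norm_gradQ_sub_le (t : ℝ) (x y : E d × E d) :
    ‖gradQ H t x - gradQ H t y‖ ≤ M * ‖x - y‖ := by
  refine norm_le_of_forall_inner_le (mul_nonneg hH.M_nonneg (norm_nonneg _)) fun v => ?_
  rw [inner_sub_left, hH.inner_gradQ, hH.inner_gradQ, ← sub_apply]
  have : ‖(v, (0 : E d))‖ = ‖v‖ := by simp [Prod.norm_def]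
  refine (Real.le_norm_self _).trans ((ContinuousLinearMap.le_opNorm _ _).trans ?_)
  rw [this]
  exact mul_le_mul_of_nonneg_right (hH.norm_fderiv_phase_sub_le t x y) (norm_nonneg _)

theorem norm_vecField_sub_le (t : ℝ) (x y : E d × E d) :
    ‖vecField H t x - vecField H t y‖ ≤ M * ‖x - y‖ := by
  rw [Prod.norm_def]
  refine max_le (hH.norm_gradP_sub_le t x y) ?_
  have := hH.norm_gradQ_sub_le t x y
  rw [← norm_neg] at this
  rwa [neg_sub, ← neg_sub_neg] at this

theorem lipschitzWith_vecField (t : ℝ) : LipschitzWith M.toNNReal (vecField H t) :=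
  LipschitzWith.of_dist_le_mul fun x y => by
    rw [dist_eq_norm, dist_eq_norm, Real.coe_toNNReal _ hH.M_nonneg]
    exact hH.norm_vecField_sub_le t x y

/-- Strong convexity in the momentum variable. -/
theorem add_inner_gradP_le (t : ℝ) (q p v : E d) :
    H t q p + ⟪gradP H t (q, p), v⟫ + m / 2 * ‖v‖ ^ 2 ≤ H t q (p + v) := by
  set f : E d → ℝ := fun p => H t q p with hf
  have hC := hH.contDiff_momentum t q
  have hline : ∀ s : ℝ, HasDerivAt (fun s : ℝ => p + s • v) v s := fun s => by
    simpa using ((hasDerivAt_id s).smul_const v).const_add p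
  have hd1 : ∀ s : ℝ, HasDerivAt (fun s : ℝ => f (p + s • v)) (fderiv ℝ f (p + s • v) v) s :=
    fun s => ((hC.differentiable (by norm_num) _).hasFDerivAt).comp_hasDerivAt s (hline s)
  have hd2 : ∀ s : ℝ, HasDerivAt (fun s : ℝ => fderiv ℝ f (p + s • v) v)
      (fderiv ℝ (fderiv ℝ f) (p + s • v) v v) s := fun s => by
    have h1 := (((hC.fderiv_right (m := 1) (by norm_num)).differentiable (by norm_num)
      (p + s • v)).hasFDerivAt).comp_hasDerivAt s (hline s)
    exact h1.clm_apply (hasDerivAt_const s v) |>.congr_deriv (by simp [hf])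
  -- The lower bound on the second derivative along the segment is integrated twice, each time as a
  -- monotonicity statement.
  have hmono : MonotoneOn (fun s : ℝ => fderiv ℝ f (p + s • v) v - s * (m * ‖v‖ ^ 2)) univ := by
    refine (monotone_of_hasDerivAt_nonneg (f' := fun s =>
      fderiv ℝ (fderiv ℝ f) (p + s • v) v v - 1 * (m * ‖v‖ ^ 2)) (fun s => ?_) fun s => ?_
      ).monotoneOn _
    · exact (hd2 s).fun_sub ((hasDerivAt_id s).mul_const _)
    · have := hH.convex t q (p + s • v) v
      simp only [Pi.zero_apply, one_mul, sub_nonneg]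
      exact this
  have hmono2 : MonotoneOn (fun s : ℝ => f (p + s • v) - s * fderiv ℝ f p v -
      s ^ 2 * (m / 2 * ‖v‖ ^ 2)) (Ici 0) := by
    have hD : ∀ s : ℝ, HasDerivAt (fun s : ℝ => f (p + s • v) - s * fderiv ℝ f p v -
        s ^ 2 * (m / 2 * ‖v‖ ^ 2)) (fderiv ℝ f (p + s • v) v - 1 * fderiv ℝ f p v -
        (2 * s) * (m / 2 * ‖v‖ ^ 2)) s := fun s => by
      refine ((hd1 s).fun_sub ((hasDerivAt_id s).mul_const _)).fun_sub
        (HasDerivAt.mul_const ?_ _)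
      simpa using hasDerivAt_pow 2 s
    refine monotoneOn_of_hasDerivWithinAt_nonneg (convex_Ici 0)
      (fun s _ => (hD s).continuousAt.continuousWithinAt)
      (fun s _ => (hD s).hasDerivWithinAt) fun s hs => ?_
    rw [interior_Ici] at hs
    have := hmono (mem_univ 0) (mem_univ s) (le_of_lt hs)
    simp only [zero_smul, add_zero, zero_mul, sub_zero] at this
    linarith
  have := hmono2 (mem_Ici.2 le_rfl) (mem_Ici.2 zero_le_one) zero_le_one
  simp only [zero_smul, add_zero, zero_mul, sub_zero, one_smul, one_mul, one_pow, ne_eq,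
    OfNat.ofNat_ne_zero, not_false_eq_true, zero_pow] at this
  rw [show ⟪gradP H t (q, p), v⟫ = fderiv ℝ f p v from inner_gradient v]
  linarith

/-- Sum of the strong convexity inequalities based at the two ends of the segment. -/
theorem le_inner_gradP_sub (t : ℝ) (q p v : E d) :
    m * ‖v‖ ^ 2 ≤ ⟪gradP H t (q, p + v) - gradP H t (q, p), v⟫ := by
  have h1 := hH.add_inner_gradP_le t q p v
  have h2 := hH.add_inner_gradP_le t q (p + v) (-v)
  rw [inner_neg_right, norm_neg, add_neg_cancel_right] at h2
  rw [inner_sub_left]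
  linarith

/-- Second order Taylor bound in the position variable. -/
theorem add_inner_gradQ_sub_le (t : ℝ) (q p v : E d) :
    H t q p + ⟪gradQ H t (q, p), v⟫ - M * ‖v‖ ^ 2 ≤ H t (q + v) p := by
  set g : E d → ℝ := fun y => H t (q + y) p - ⟪gradQ H t (q, p), y⟫ with hg
  have hd : ∀ y, HasFDerivAt g (fderiv ℝ (fun q => H t q p) (q + y) -
      innerSL ℝ (gradQ H t (q, p))) y := fun y => by
    refine HasFDerivAt.fun_sub ?_ (innerSL ℝ (gradQ H t (q, p))).hasFDerivAt
    simpa [Function.comp_def] using ((hH.contDiff_position t p).differentiable (by norm_num)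
      (q + y)).hasFDerivAt.comp y ((hasFDerivAt_id y).const_add q)
  have hb : ∀ y ∈ Metric.closedBall (0 : E d) ‖v‖, ‖fderiv ℝ (fun q => H t q p) (q + y) -
      innerSL ℝ (gradQ H t (q, p))‖ ≤ M * ‖v‖ := fun y hy => by
    refine ContinuousLinearMap.opNorm_le_bound _ (mul_nonneg hH.M_nonneg (norm_nonneg _))
      fun w => ?_
    have h1 : fderiv ℝ (fun q => H t q p) (q + y) w = ⟪gradQ H t (q + y, p), w⟫ :=
      (inner_gradient w).symm
    rw [sub_apply, h1, innerSL_apply_apply, ← inner_sub_left]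
    refine (norm_inner_le_norm _ _).trans (mul_le_mul_of_nonneg_right ?_ (norm_nonneg _))
    refine (hH.norm_gradQ_sub_le t _ _).trans (mul_le_mul_of_nonneg_left ?_ hH.M_nonneg)
    simpa [Prod.norm_def] using hy
  have := (convex_closedBall (0 : E d) ‖v‖).norm_image_sub_le_of_norm_hasFDerivWithin_le
    (fun y _ => (hd y).hasFDerivWithinAt) hb (x := 0) (y := v) (by simp) (by simp)
  simp only [hg, add_zero, inner_zero_right, sub_zero, Real.norm_eq_abs] at this
  have h2 := (abs_le.1 this).1
  nlinarith

theorem exists_isOrbit (t : ℝ) (z : E d × E d) : ∃ x, IsOrbit H x ∧ x t = z := by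
  obtain ⟨x, h1, h2⟩ := exists_forall_hasDerivAt_of_lipschitzWith hH.contDiff_vecField
    hH.lipschitzWith_vecField t z
  exact ⟨x, h2, h1⟩

theorem isOrbit_unique {x y : ℝ → E d × E d} (hx : IsOrbit H x) (hy : IsOrbit H y) {t : ℝ}
    (h : x t = y t) : x = y :=
  ODE_solution_unique_univ (v := vecField H) (s := fun _ => univ)
    (fun t => (hH.lipschitzWith_vecField t).lipschitzOnWith) (fun t => ⟨hx t, mem_univ _⟩)
    (fun t => ⟨hy t, mem_univ _⟩) h

end IsConvexHamiltonian

/-! ### Existence of a twist time. -/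

/-- A strongly monotone Lipschitz map is surjective. -/
theorem surjective_of_strongly_monotone {Q : E d → E d} {c Λ : ℝ} (hc : 0 < c)
    (hmono : ∀ x y, c * ‖x - y‖ ^ 2 ≤ ⟪Q x - Q y, x - y⟫)
    (hlip : ∀ x y, ‖Q x - Q y‖ ≤ Λ * ‖x - y‖) : Function.Surjective Q := by
  intro z
  set N : ℝ := |Λ| + c with hN
  have hN0 : 0 < N := by positivity
  have hcN : c ≤ N := by simp [hN]
  -- This step size minimises `1 - 2 * lam * c + lam ^ 2 * N ^ 2`, the bound on the squared
  -- Lipschitz constant of `x ↦ x - lam • (Q x - z)`. Its fixed point solves `Q x = z`.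
  set lam : ℝ := c / N ^ 2 with hlam
  have hlam0 : 0 < lam := by positivity
  set k : ℝ := Real.sqrt (1 - c ^ 2 / N ^ 2) with hk
  have hk0 : 0 ≤ 1 - c ^ 2 / N ^ 2 := by
    rw [sub_nonneg, div_le_one (by positivity)]
    exact pow_le_pow_left₀ hc.le hcN 2
  have hk1 : k < 1 := by
    rw [hk, Real.sqrt_lt' one_pos]
    have : 0 < c ^ 2 / N ^ 2 := by positivity
    linarith
  have hbound : ∀ x y, ‖(x - lam • (Q x - z)) - (y - lam • (Q y - z))‖ ≤ k * ‖x - y‖ := by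
    intro x y
    have h1 : (x - lam • (Q x - z)) - (y - lam • (Q y - z)) = (x - y) - lam • (Q x - Q y) := by
      module
    have h2 : ‖Q x - Q y‖ ^ 2 ≤ N ^ 2 * ‖x - y‖ ^ 2 := by
      rw [← mul_pow]
      refine pow_le_pow_left₀ (norm_nonneg _) ((hlip x y).trans ?_) 2
      exact mul_le_mul_of_nonneg_right ((le_abs_self Λ).trans (by simp [hN, hc.le]))
        (norm_nonneg _)
    rw [h1]
    refine abs_le_of_sq_le_sq' ?_ (by positivity) |>.2
    rw [norm_sub_sq_real, mul_pow, hk, Real.sq_sqrt hk0, real_inner_smul_right, norm_smul,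
      Real.norm_of_nonneg hlam0.le, mul_pow, real_inner_comm]
    have h3 := hmono x y
    have h4 : lam * (c * ‖x - y‖ ^ 2) ≤ lam * ⟪Q x - Q y, x - y⟫ :=
      mul_le_mul_of_nonneg_left h3 hlam0.le
    have h5 : lam ^ 2 * ‖Q x - Q y‖ ^ 2 ≤ lam ^ 2 * (N ^ 2 * ‖x - y‖ ^ 2) :=
      mul_le_mul_of_nonneg_left h2 (by positivity)
    have h6 : lam ^ 2 * (N ^ 2 * ‖x - y‖ ^ 2) = c ^ 2 / N ^ 2 * ‖x - y‖ ^ 2 := by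
      rw [hlam]; field_simp
    have h7 : lam * (c * ‖x - y‖ ^ 2) = c ^ 2 / N ^ 2 * ‖x - y‖ ^ 2 := by
      rw [hlam]; field_simp
    linarith
  have hcontr : ContractingWith k.toNNReal (fun x => x - lam • (Q x - z)) := by
    refine ⟨?_, LipschitzWith.of_dist_le_mul fun x y => ?_⟩
    · rw [← NNReal.coe_lt_coe, Real.coe_toNNReal _ (Real.sqrt_nonneg _)]
      exact hk1
    · rw [dist_eq_norm, dist_eq_norm, Real.coe_toNNReal _ (Real.sqrt_nonneg _)]
      exact hbound x y
  refine ⟨hcontr.fixedPoint, ?_⟩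
  have h := hcontr.fixedPoint_isFixedPt
  have h1 : lam • (Q hcontr.fixedPoint - z) = 0 := by
    have h' : hcontr.fixedPoint - lam • (Q hcontr.fixedPoint - z) = hcontr.fixedPoint := h
    simpa using h'
  rcases smul_eq_zero.1 h1 with h2 | h2
  · exact absurd h2 hlam0.ne'
  · exact sub_eq_zero.1 h2

namespace IsConvexHamiltonian

variable (hH : IsConvexHamiltonian H m M)
include hH

theorem norm_orbit_sub_le {x y : ℝ → E d × E d} (hx : IsOrbit H x) (hy : IsOrbit H y) {τ s : ℝ}
    (hs : τ ≤ s) : ‖x s - y s‖ ≤ ‖x τ - y τ‖ * Real.exp (M * (s - τ)) := by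
  have := dist_le_of_trajectories_ODE (v := vecField H) (a := τ) (b := s)
    hH.lipschitzWith_vecField (HasDerivAt.continuousOn fun t _ => hx t)
    (fun t _ => (hx t).hasDerivWithinAt) (HasDerivAt.continuousOn fun t _ => hy t)
    (fun t _ => (hy t).hasDerivWithinAt) le_rfl s ⟨hs, le_rfl⟩
  rwa [dist_eq_norm, dist_eq_norm, Real.coe_toNNReal _ hH.M_nonneg] at this

/-- By Grönwall, the difference of two orbits stays nearly constant over a short time; in the twist
estimate this keeps it close to the initial vertical difference `(0, w)`. -/
theorem norm_orbit_sub_sub_le {x y : ℝ → E d × E d} (hx : IsOrbit H x) (hy : IsOrbit H y)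
    {τ s σ : ℝ} (hs : τ ≤ s) (hσ : s - τ ≤ σ) :
    ‖(x s - y s) - (x τ - y τ)‖ ≤ M * Real.exp (M * σ) * σ * ‖x τ - y τ‖ := by
  have hM := hH.M_nonneg
  have h := (convex_Icc τ s).norm_image_sub_le_of_norm_hasDerivWithin_le
    (f := fun r => x r - y r) (C := M * (‖x τ - y τ‖ * Real.exp (M * σ))) (x := τ) (y := s)
    (fun r _ => ((hx r).fun_sub (hy r)).hasDerivWithinAt)
    (fun r hr => (hH.norm_vecField_sub_le r _ _).trans (mul_le_mul_of_nonneg_left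
      ((hH.norm_orbit_sub_le hx hy hr.1).trans (mul_le_mul_of_nonneg_left
        (Real.exp_le_exp.2 (mul_le_mul_of_nonneg_left (by linarith [hr.2]) hM))
        (norm_nonneg _))) hM))
    ⟨le_rfl, hs⟩ ⟨hs, le_rfl⟩
  refine h.trans ?_
  rw [Real.norm_of_nonneg (sub_nonneg.2 hs)]
  calc M * (‖x τ - y τ‖ * Real.exp (M * σ)) * (s - τ)
      ≤ M * (‖x τ - y τ‖ * Real.exp (M * σ)) * σ := mul_le_mul_of_nonneg_left hσ (by positivity)
    _ = _ := by ring

/-- Twist property: over a short time the final position is a strongly monotone function of the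
initial momentum. -/
theorem le_inner_orbit_sub {x y : ℝ → E d × E d} (hx : IsOrbit H x) (hy : IsOrbit H y)
    {τ t σ : ℝ} (ht : τ ≤ t) (hσ : t - τ ≤ σ) (hsmall : M * (M * Real.exp (M * σ) * σ) ≤ m / 2)
    (hq : (x τ).1 = (y τ).1) :
    m / 2 * (t - τ) * ‖(x τ).2 - (y τ).2‖ ^ 2 ≤
      ⟪(x t).1 - (y t).1, (x τ).2 - (y τ).2⟫ := by
  set w := (x τ).2 - (y τ).2 with hw
  have hD : x τ - y τ = (0, w) := Prod.ext (by simp [hq]) rfl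
  have hDn : ‖x τ - y τ‖ = ‖w‖ := by simp [hD, Prod.norm_def]
  have hd : ∀ s, HasDerivAt (fun s => ⟪(x s).1 - (y s).1, w⟫ - m / 2 * ‖w‖ ^ 2 * s)
      (⟪gradP H s (x s) - gradP H s (y s), w⟫ - m / 2 * ‖w‖ ^ 2 * 1) s := fun s => by
    have h1 : HasDerivAt (fun s => (x s).1 - (y s).1) (gradP H s (x s) - gradP H s (y s)) s :=
      (hx.hasDerivAt_fst s).fun_sub (hy.hasDerivAt_fst s)
    have h2 := h1.inner ℝ (hasDerivAt_const s w)
    simp only [inner_zero_right, zero_add] at h2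
    exact h2.fun_sub ((hasDerivAt_id s).const_mul _)
  have hmono : MonotoneOn (fun s => ⟪(x s).1 - (y s).1, w⟫ - m / 2 * ‖w‖ ^ 2 * s) (Icc τ t) := by
    refine monotoneOn_of_hasDerivWithinAt_nonneg (convex_Icc τ t)
      (fun s _ => (hd s).continuousAt.continuousWithinAt)
      (fun s _ => (hd s).hasDerivWithinAt) fun s hs => ?_
    rw [interior_Icc] at hs
    have h1 := hH.le_inner_gradP_sub s (y s).1 (y s).2 w
    -- Replacing `x s` by `y s + (0, w)` costs at most half of the strong monotonicity `m * ‖w‖ ^ 2`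
    -- of `∂_pH` in the momentum.
    have h2 : ‖gradP H s (x s) - gradP H s ((y s).1, (y s).2 + w)‖ ≤ m / 2 * ‖w‖ := by
      refine (hH.norm_gradP_sub_le s _ _).trans ?_
      have h3 : x s - ((y s).1, (y s).2 + w) = (x s - y s) - (x τ - y τ) := by
        rw [hD]
        ext1 <;> simp [sub_sub]
      rw [h3]
      have h4 := hH.norm_orbit_sub_sub_le hx hy hs.1.le (σ := σ) (by linarith [hs.2])
      rw [hDn] at h4
      calc M * ‖(x s - y s) - (x τ - y τ)‖ ≤ M * (M * Real.exp (M * σ) * σ * ‖w‖) :=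
            mul_le_mul_of_nonneg_left h4 hH.M_nonneg
        _ = M * (M * Real.exp (M * σ) * σ) * ‖w‖ := by ring
        _ ≤ _ := mul_le_mul_of_nonneg_right hsmall (norm_nonneg _)
    have h5 := neg_le_of_abs_le ((abs_real_inner_le_norm
      (gradP H s (x s) - gradP H s ((y s).1, (y s).2 + w)) w).trans
      (mul_le_mul_of_nonneg_right h2 (norm_nonneg _)))
    have h6 : ⟪gradP H s (x s) - gradP H s (y s), w⟫ =
        ⟪gradP H s (x s) - gradP H s ((y s).1, (y s).2 + w), w⟫ +
        ⟪gradP H s ((y s).1, (y s).2 + w) - gradP H s ((y s).1, (y s).2), w⟫ := by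
      rw [← inner_add_left]; simp
    rw [h6]
    nlinarith
  have := hmono ⟨le_rfl, ht⟩ ⟨ht, le_rfl⟩ ht
  simp only [hq, sub_self, inner_zero_left, zero_sub] at this
  linarith

/-- `σ` is taken so small that `p ↦ q(t)` is strongly monotone with constant `m / 2 * (t - τ)`, for
all `τ` at once. Existence is the surjectivity of this map; uniqueness is the same monotonicity
together with uniqueness of orbits. -/
theorem exists_isTwistTime : ∃ σ, IsTwistTime H σ := by
  have hm := hH.m_pos
  have hlim : Tendsto (fun σ : ℝ => M * (M * Real.exp (M * σ) * σ)) (𝓝[>] 0) (𝓝 0) := by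
    have hc : Continuous (fun σ : ℝ => M * (M * Real.exp (M * σ) * σ)) := by fun_prop
    have := hc.tendsto 0
    simp only [mul_zero] at this
    exact this.mono_left nhdsWithin_le_nhds
  obtain ⟨σ, hsmall, hσ⟩ :=
    ((hlim.eventually (ge_mem_nhds (half_pos hm))).and self_mem_nhdsWithin).exists
  refine ⟨σ, hσ, fun τ t hlt hle q₀ q₁ => ?_⟩
  have hpos : 0 < m / 2 * (t - τ) := mul_pos (half_pos hm) (sub_pos.2 hlt)
  choose X hX hX0 using fun p => hH.exists_isOrbit τ (q₀, p)
  have hmono : ∀ p p', m / 2 * (t - τ) * ‖p - p'‖ ^ 2 ≤ ⟪(X p t).1 - (X p' t).1, p - p'⟫ :=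
    fun p p' => by
      have := hH.le_inner_orbit_sub (hX p) (hX p') hlt.le hle hsmall (by simp [hX0])
      simpa [hX0] using this
  have hlip : ∀ p p', ‖(X p t).1 - (X p' t).1‖ ≤ Real.exp (M * (t - τ)) * ‖p - p'‖ :=
    fun p p' => by
      have := hH.norm_orbit_sub_le (hX p) (hX p') hlt.le
      have h2 : ‖X p τ - X p' τ‖ = ‖p - p'‖ := by simp [hX0, Prod.norm_def]
      rw [h2, mul_comm] at this
      exact (norm_fst_le (X p t - X p' t)).trans this
  obtain ⟨p, hp⟩ := surjective_of_strongly_monotone hpos hmono hlip q₁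
  replace hp : (X p t).1 = q₁ := hp
  refine ⟨X p, ⟨hX p, by simp [hX0], hp⟩, ?_⟩
  rintro y ⟨hy, hy0, hy1⟩
  have h := hH.le_inner_orbit_sub hy (hX p) hlt.le hle hsmall (by simp [hX0, hy0])
  rw [hy1, hp, sub_self, inner_zero_left] at h
  have h2 : ‖(y τ).2 - (X p τ).2‖ ^ 2 ≤ 0 := by
    by_contra hcon
    exact absurd h (not_le.2 (mul_pos hpos (not_le.1 hcon)))
  have h3 : (y τ).2 = (X p τ).2 := by
    have := pow_eq_zero_iff (two_ne_zero) |>.1 (le_antisymm h2 (sq_nonneg _))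
    exact sub_eq_zero.1 (norm_eq_zero.1 this)
  exact hH.isOrbit_unique hy (hX p) (t := τ) (Prod.ext (by simp [hX0, hy0]) h3)

end IsConvexHamiltonian

/-! ### Differential of a `C¹` solution. -/

theorem isOpen_timeInterval : IsOpen (timeInterval t₀ t₁) :=
  isOpen_Ioo.preimage continuous_coe_real_ereal

theorem ordConnected_timeInterval : OrdConnected (timeInterval t₀ t₁) :=
  ⟨fun _ ha _ hb _ hs => ⟨ha.1.trans_le (EReal.coe_le_coe_iff.2 hs.1),
    (EReal.coe_le_coe_iff.2 hs.2).trans_lt hb.2⟩⟩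

theorem isOpen_timeInterval_prod : IsOpen (timeInterval t₀ t₁ ×ˢ (univ : Set (E d))) :=
  isOpen_timeInterval.prod isOpen_univ

/-- The gradient in the space variable. -/
noncomputable def spaceGrad (u : ℝ → E d → ℝ) (z : ℝ × E d) : E d := gradient (u z.1) z.2

namespace IsC1Solution

variable (hu : IsC1Solution H t₀ t₁ u)
include hu

theorem hasFDerivAt {t : ℝ} (ht : t ∈ timeInterval t₀ t₁) (q : E d) :
    HasFDerivAt (fun z : ℝ × E d => u z.1 z.2)
      (fderiv ℝ (fun z : ℝ × E d => u z.1 z.2) (t, q)) (t, q) :=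
  ((hu.1.contDiffAt (isOpen_timeInterval_prod.mem_nhds ⟨ht, mem_univ q⟩)).differentiableAt
    (by norm_num)).hasFDerivAt

theorem fderiv_slice {t : ℝ} (ht : t ∈ timeInterval t₀ t₁) (q : E d) :
    fderiv ℝ (u t) q = (fderiv ℝ (fun z : ℝ × E d => u z.1 z.2) (t, q)).comp
      (ContinuousLinearMap.inr ℝ ℝ (E d)) :=
  (HasFDerivAt.comp (f := fun q => (t, q)) q (hu.hasFDerivAt ht q)
    (hasFDerivAt_prodMk_right t q)).fderiv

/-- The equation eliminates `∂_t u`, so the full differential depends only on the space gradient. -/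
theorem fderiv_apply {t : ℝ} (ht : t ∈ timeInterval t₀ t₁) (q : E d) (a : ℝ) (w : E d) :
    fderiv ℝ (fun z : ℝ × E d => u z.1 z.2) (t, q) (a, w) =
      ⟪spaceGrad u (t, q), w⟫ - a * H t q (spaceGrad u (t, q)) := by
  have h1 : fderiv ℝ (fun z : ℝ × E d => u z.1 z.2) (t, q) (0, w) = ⟪spaceGrad u (t, q), w⟫ := by
    rw [spaceGrad, inner_gradient, hu.fderiv_slice ht]
    simp
  have h2 : fderiv ℝ (fun z : ℝ × E d => u z.1 z.2) (t, q) (1, 0) =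
      - H t q (spaceGrad u (t, q)) := by
    have h3 := (HasFDerivAt.comp (f := fun s => (s, q)) t (hu.hasFDerivAt ht q)
      (hasFDerivAt_prodMk_left t q)).hasDerivAt.deriv
    have h4 := hu.2 t ht q
    rw [show (fun s => u s q) = (fun z : ℝ × E d => u z.1 z.2) ∘ fun s => (s, q) from rfl, h3] at h4
    simp only [ContinuousLinearMap.comp_apply, ContinuousLinearMap.inl_apply] at h4
    rw [spaceGrad]
    linarith
  have h5 : ((a, w) : ℝ × E d) = a • ((1 : ℝ), (0 : E d)) + ((0 : ℝ), w) := by simp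
  rw [h5, map_add, map_smul, h1, h2, smul_eq_mul]
  ring

theorem continuousOn_fderiv :
    ContinuousOn (fderiv ℝ (fun z : ℝ × E d => u z.1 z.2)) (timeInterval t₀ t₁ ×ˢ univ) :=
  hu.1.continuousOn_fderiv_of_isOpen isOpen_timeInterval_prod (by norm_num)

theorem continuousOn_spaceGrad : ContinuousOn (spaceGrad u) (timeInterval t₀ t₁ ×ˢ univ) := by
  have h : ContinuousOn (fun z : ℝ × E d => (InnerProductSpace.toDual ℝ (E d)).symm
      ((fderiv ℝ (fun z : ℝ × E d => u z.1 z.2) z).comp (ContinuousLinearMap.inr ℝ ℝ (E d))))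
      (timeInterval t₀ t₁ ×ˢ univ) :=
    (InnerProductSpace.toDual ℝ (E d)).symm.continuous.comp_continuousOn
      (hu.continuousOn_fderiv.clm_comp continuousOn_const)
  refine h.congr fun z hz => ?_
  rw [spaceGrad, gradient, hu.fderiv_slice hz.1]

theorem continuousAt_spaceGrad {t : ℝ} (ht : t ∈ timeInterval t₀ t₁) (q : E d) :
    ContinuousAt (spaceGrad u) (t, q) :=
  hu.continuousOn_spaceGrad.continuousAt (isOpen_timeInterval_prod.mem_nhds ⟨ht, mem_univ q⟩)

theorem continuousAt_spaceGrad_comp {c : ℝ → E d} {s : ℝ} (hs : s ∈ timeInterval t₀ t₁)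
    (hc : ContinuousAt c s) : ContinuousAt (fun s => spaceGrad u (s, c s)) s :=
  ContinuousAt.comp (f := fun s => (s, c s)) (hu.continuousAt_spaceGrad hs (c s))
    (continuousAt_id.prodMk hc)

theorem hasDerivAt_comp {c : ℝ → E d} {c' : E d} {s : ℝ} (hs : s ∈ timeInterval t₀ t₁)
    (hc : HasDerivAt c c' s) : HasDerivAt (fun s => u s (c s))
      (⟪spaceGrad u (s, c s), c'⟫ - H s (c s) (spaceGrad u (s, c s))) s := by
  have h := HasFDerivAt.comp_hasDerivAt (f := fun s => (s, c s)) s (hu.hasFDerivAt hs (c s))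
    ((hasDerivAt_id s).prodMk hc)
  rw [hu.fderiv_apply hs, one_mul] at h
  exact h

end IsC1Solution

/-! ### Domination, calibration and the perturbation estimate. -/

/-- The rate of change of `u` along a curve moving with velocity `v` when its gradient is `p`. -/
noncomputable def rate (H : ℝ → E d → E d → ℝ) (s : ℝ) (q p v : E d) : ℝ := ⟪p, v⟫ - H s q p

namespace IsConvexHamiltonian

variable (hH : IsConvexHamiltonian H m M)
include hH

theorem continuous_uncurried : Continuous (fun z : ℝ × E d × E d => H z.1 z.2.1 z.2.2) :=
  hH.contDiff.continuous

/-- The Legendre inequality. -/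
theorem rate_le (s : ℝ) (q p P : E d) :
    rate H s q P (gradP H s (q, p)) ≤ rate H s q p (gradP H s (q, p)) := by
  have h := hH.add_inner_gradP_le s q p (P - p)
  rw [add_sub_cancel, inner_sub_right] at h
  have h2 : 0 ≤ m / 2 * ‖P - p‖ ^ 2 := mul_nonneg (half_pos hH.m_pos).le (sq_nonneg _)
  rw [rate, rate, real_inner_comm, real_inner_comm _ p]
  linarith

/-- `P` is arbitrary, so no regularity of `∂_q u` is needed when it is the gradient at the displaced
point. Strong convexity supplies `-m / 2 * ‖P - p‖ ^ 2`; the terms linear in `P - p` cancel up to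
`(M * ‖η‖ + ‖η'‖) * ‖P - p‖`, which Young's inequality absorbs. -/
theorem rate_add_le (s : ℝ) (q p P η η' : E d) :
    rate H s (q + η) P (gradP H s (q, p) + η') ≤ rate H s q p (gradP H s (q, p)) +
      (⟪p, η'⟫ - ⟪gradQ H s (q, p), η⟫) + (M + (M ^ 2 + 1) / m) * (‖η‖ ^ 2 + ‖η'‖ ^ 2) := by
  have hm := hH.m_pos
  have hM := hH.M_nonneg
  have h1 := hH.add_inner_gradP_le s (q + η) p (P - p)
  rw [add_sub_cancel] at h1
  have h2 := hH.add_inner_gradQ_sub_le s q p η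
  have h3 : ‖gradP H s (q, p) - gradP H s (q + η, p)‖ ≤ M * ‖η‖ := by
    refine (hH.norm_gradP_sub_le s _ _).trans (le_of_eq ?_)
    simp [Prod.norm_def]
  have h4 : ⟪gradP H s (q, p) - gradP H s (q + η, p) + η', P - p⟫ ≤
      (M * ‖η‖ + ‖η'‖) * ‖P - p‖ := by
    refine (real_inner_le_norm _ _).trans (mul_le_mul_of_nonneg_right ?_ (norm_nonneg _))
    exact (norm_add_le _ _).trans (by gcongr)
  have h5 : (M * ‖η‖ + ‖η'‖) * ‖P - p‖ - m / 2 * ‖P - p‖ ^ 2 ≤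
      (M ^ 2 + 1) / m * (‖η‖ ^ 2 + ‖η'‖ ^ 2) := by
    rw [div_mul_eq_mul_div (M ^ 2 + 1), le_div_iff₀ hm]
    nlinarith [sq_nonneg (M * ‖η‖ + ‖η'‖ - m * ‖P - p‖), sq_nonneg (M * ‖η‖ - ‖η'‖),
      mul_nonneg (sq_nonneg M) (sq_nonneg ‖η'‖), sq_nonneg ‖η‖]
  have h6 : ⟪P, gradP H s (q, p) + η'⟫ = ⟪p, gradP H s (q, p)⟫ + ⟪p, η'⟫ +
      ⟪gradP H s (q + η, p), P - p⟫ + ⟪gradP H s (q, p) - gradP H s (q + η, p) + η', P - p⟫ := by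
    simp only [inner_add_right, inner_add_left, inner_sub_left, inner_sub_right]
    rw [real_inner_comm P (gradP H s (q, p)), real_inner_comm p (gradP H s (q, p)),
      real_inner_comm P η', real_inner_comm p η']
    ring
  have h7 : M * ‖η‖ ^ 2 ≤ M * (‖η‖ ^ 2 + ‖η'‖ ^ 2) :=
    mul_le_mul_of_nonneg_left (by linarith [sq_nonneg ‖η'‖]) hM
  rw [rate, rate, h6, add_mul]
  linarith

end IsConvexHamiltonian

section Calibration

variable (hH : IsConvexHamiltonian H m M) (hu : IsC1Solution H t₀ t₁ u)
include hH hu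

theorem continuousOn_rate {c c' : ℝ → E d} {a b : ℝ} (ha : a ∈ timeInterval t₀ t₁)
    (hb : b ∈ timeInterval t₀ t₁) (hc : ContinuousOn c (Icc a b))
    (hc' : ContinuousOn c' (Icc a b)) :
    ContinuousOn (fun s => rate H s (c s) (spaceGrad u (s, c s)) (c' s)) (Icc a b) := by
  have hP : ContinuousOn (fun s => spaceGrad u (s, c s)) (Icc a b) :=
    hu.continuousOn_spaceGrad.comp (continuousOn_id.prodMk hc) fun s hs =>
      ⟨ordConnected_timeInterval.out ha hb hs, mem_univ _⟩
  exact (hP.inner hc').sub (hH.continuous_uncurried.comp_continuousOn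
    (continuousOn_id.prodMk (hc.prodMk hP)))

theorem integral_rate {c c' : ℝ → E d} {a b : ℝ} (ha : a ∈ timeInterval t₀ t₁)
    (hb : b ∈ timeInterval t₀ t₁) (hab : a ≤ b) (hc : ∀ s ∈ Icc a b, HasDerivAt c (c' s) s)
    (hc' : ContinuousOn c' (Icc a b)) :
    ∫ s in a..b, rate H s (c s) (spaceGrad u (s, c s)) (c' s) = u b (c b) - u a (c a) := by
  refine intervalIntegral.integral_eq_sub_of_hasDerivAt (f := fun s => u s (c s))
    (fun s hs => ?_) ?_
  · rw [uIcc_of_le hab] at hs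
    exact hu.hasDerivAt_comp (ordConnected_timeInterval.out ha hb hs) (hc s hs)
  · refine ContinuousOn.intervalIntegrable ?_
    rw [uIcc_of_le hab]
    exact continuousOn_rate hH hu ha hb (HasDerivAt.continuousOn hc) hc'

omit hH hu in
theorem action_eq {x : ℝ → E d × E d} (hx : IsOrbit H x) (a b : ℝ) :
    action H a b x = ∫ s in a..b, rate H s (x s).1 (x s).2 (gradP H s (x s)) := by
  unfold action rate
  congr 1
  funext s
  rw [(hx.hasDerivAt_fst s).deriv]

omit hu in
theorem continuous_gradP_orbit {x : ℝ → E d × E d} (hx : IsOrbit H x) :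
    Continuous (fun s => gradP H s (x s)) :=
  hH.contDiff_gradP.continuous.comp (continuous_id.prodMk hx.continuous)

/-- A `C¹` solution is dominated by the action. -/
theorem sub_le_action {x : ℝ → E d × E d} (hx : IsOrbit H x) {a b : ℝ}
    (ha : a ∈ timeInterval t₀ t₁) (hb : b ∈ timeInterval t₀ t₁) (hab : a ≤ b) :
    u b (x b).1 - u a (x a).1 ≤ action H a b x := by
  have hg := continuous_gradP_orbit hH hx
  rw [action_eq hx, ← integral_rate hH hu ha hb hab (fun s _ => hx.hasDerivAt_fst s)
    hg.continuousOn]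
  refine intervalIntegral.integral_mono_on hab ?_ ?_ fun s _ => hH.rate_le s _ _ _
  · refine ContinuousOn.intervalIntegrable ?_
    rw [uIcc_of_le hab]
    exact continuousOn_rate hH hu ha hb (continuous_fst.comp hx.continuous).continuousOn
      hg.continuousOn
  · refine Continuous.intervalIntegrable ?_ _ _
    exact ((continuous_snd.comp hx.continuous).inner hg).sub
      (hH.continuous_uncurried.comp (continuous_id.prodMk hx.continuous))

/-- The action of an orbit contained in the graph of the gradient of a `C¹` solution. -/
theorem action_eq_sub {x : ℝ → E d × E d} (hx : IsOrbit H x) {a b : ℝ}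
    (ha : a ∈ timeInterval t₀ t₁) (hb : b ∈ timeInterval t₀ t₁) (hab : a ≤ b)
    (hgraph : ∀ s ∈ timeInterval t₀ t₁, (x s).2 = spaceGrad u (s, (x s).1)) :
    action H a b x = u b (x b).1 - u a (x a).1 := by
  rw [action_eq hx, ← integral_rate hH hu ha hb hab (fun s _ => hx.hasDerivAt_fst s)
    (continuous_gradP_orbit hH hx).continuousOn]
  refine intervalIntegral.integral_congr fun s hs => ?_
  rw [uIcc_of_le hab] at hs
  rw [← hgraph s (ordConnected_timeInterval.out ha hb hs)]

/-- Comparison of a characteristic curve `c` with its perturbation `c + η`. -/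
theorem perturbation_le {c η η' : ℝ → E d} {a b B : ℝ} (ha : a ∈ timeInterval t₀ t₁)
    (hb : b ∈ timeInterval t₀ t₁) (hab : a ≤ b)
    (hc : ∀ s ∈ Icc a b, HasDerivAt c (gradP H s (c s, spaceGrad u (s, c s))) s)
    (hη : ∀ s ∈ Icc a b, HasDerivAt η (η' s) s) (hη' : ContinuousOn η' (Icc a b))
    (hB : ∀ s ∈ Icc a b, ‖η s‖ ^ 2 + ‖η' s‖ ^ 2 ≤ B) :
    u b (c b + η b) - u a (c a + η a) ≤ u b (c b) - u a (c a) +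
      (∫ s in a..b, (⟪spaceGrad u (s, c s), η' s⟫ -
        ⟪gradQ H s (c s, spaceGrad u (s, c s)), η s⟫)) +
      (M + (M ^ 2 + 1) / m) * B * (b - a) := by
  have hcc : ContinuousOn c (Icc a b) := HasDerivAt.continuousOn hc
  have hηc : ContinuousOn η (Icc a b) := HasDerivAt.continuousOn hη
  have hP : ContinuousOn (fun s => spaceGrad u (s, c s)) (Icc a b) :=
    hu.continuousOn_spaceGrad.comp (continuousOn_id.prodMk hcc) fun s hs =>
      ⟨ordConnected_timeInterval.out ha hb hs, mem_univ _⟩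
  have hgP : ContinuousOn (fun s => gradP H s (c s, spaceGrad u (s, c s))) (Icc a b) :=
    hH.contDiff_gradP.continuous.comp_continuousOn (continuousOn_id.prodMk (hcc.prodMk hP))
  have hgQ : ContinuousOn (fun s => gradQ H s (c s, spaceGrad u (s, c s))) (Icc a b) :=
    hH.contDiff_gradQ.continuous.comp_continuousOn (continuousOn_id.prodMk (hcc.prodMk hP))
  have i1 : IntervalIntegrable (fun s => rate H s (c s) (spaceGrad u (s, c s))
      (gradP H s (c s, spaceGrad u (s, c s)))) volume a b :=
    (uIcc_of_le hab ▸ continuousOn_rate hH hu ha hb hcc hgP :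
      ContinuousOn _ (uIcc a b)).intervalIntegrable
  have i2 : IntervalIntegrable (fun s => ⟪spaceGrad u (s, c s), η' s⟫ -
      ⟪gradQ H s (c s, spaceGrad u (s, c s)), η s⟫) volume a b :=
    (uIcc_of_le hab ▸ (hP.inner hη').sub (hgQ.inner hηc) :
      ContinuousOn _ (uIcc a b)).intervalIntegrable
  have i3 : IntervalIntegrable (fun _ : ℝ => (M + (M ^ 2 + 1) / m) * B) volume a b :=
    intervalIntegrable_const
  have i4 : IntervalIntegrable (fun s => rate H s (c s + η s) (spaceGrad u (s, c s + η s))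
      (gradP H s (c s, spaceGrad u (s, c s)) + η' s)) volume a b :=
    (uIcc_of_le hab ▸ continuousOn_rate hH hu ha hb (hcc.add hηc) (hgP.add hη') :
      ContinuousOn _ (uIcc a b)).intervalIntegrable
  have hC : 0 ≤ M + (M ^ 2 + 1) / m := by
    have := hH.m_pos
    have := hH.M_nonneg
    positivity
  rw [← integral_rate hH hu ha hb hab (c := fun s => c s + η s)
    (fun s hs => (hc s hs).fun_add (hη s hs)) (hgP.add hη'),
    ← integral_rate hH hu ha hb hab hc hgP,
    show (M + (M ^ 2 + 1) / m) * B * (b - a) = ∫ _ in a..b, (M + (M ^ 2 + 1) / m) * B by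
      rw [intervalIntegral.integral_const, smul_eq_mul, mul_comm],
    ← intervalIntegral.integral_add i1 i2, ← intervalIntegral.integral_add (i1.add i2) i3]
  -- Pointwise comparison, with `P` the gradient of `u` at the perturbed point.
  refine intervalIntegral.integral_mono_on hab i4 ((i1.add i2).add i3) fun s hs => ?_
  exact (hH.rate_add_le s (c s) (spaceGrad u (s, c s)) _ (η s) (η' s)).trans
    (add_le_add le_rfl (mul_le_mul_of_nonneg_left (hB s hs) hC))

end Calibration

/-! ### Characteristics and invariance of the graph. -/

theorem eq_zero_of_forall_nonneg_add {J K : ℝ} (h : ∀ ε : ℝ, 0 ≤ ε * J + ε ^ 2 * K) : J = 0 := by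
  have h1 : Tendsto (fun ε : ℝ => J + ε * K) (𝓝[>] 0) (𝓝 J) := by
    have hc : Continuous (fun ε : ℝ => J + ε * K) := by fun_prop
    simpa using (hc.tendsto 0).mono_left nhdsWithin_le_nhds
  have h2 : Tendsto (fun ε : ℝ => J + ε * K) (𝓝[<] 0) (𝓝 J) := by
    have hc : Continuous (fun ε : ℝ => J + ε * K) := by fun_prop
    simpa using (hc.tendsto 0).mono_left nhdsWithin_le_nhds
  refine le_antisymm (le_of_tendsto h2 ?_) (ge_of_tendsto h1 ?_)
  · filter_upwards [self_mem_nhdsWithin] with ε hε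
    have := h ε
    rw [show ε * J + ε ^ 2 * K = ε * (J + ε * K) by ring] at this
    exact nonpos_of_mul_nonneg_right this hε
  · filter_upwards [self_mem_nhdsWithin] with ε hε
    have := h ε
    rw [show ε * J + ε ^ 2 * K = ε * (J + ε * K) by ring] at this
    exact nonneg_of_mul_nonneg_right this hε

/-- The **du Bois-Reymond lemma**: a continuous `p` with weak derivative `-G` is differentiable. -/
theorem hasDerivAt_of_forall_integral_eq_zero {p G : ℝ → E d} {α β : ℝ}
    (hp : ContinuousOn p (Ioo α β)) (hG : ContinuousOn G (Ioo α β))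
    (hweak : ∀ a b, a ∈ Ioo α β → b ∈ Ioo α β → a < b → ∀ η η' : ℝ → E d,
      (∀ s ∈ Icc a b, HasDerivAt η (η' s) s) → ContinuousOn η' (Icc a b) → η a = 0 → η b = 0 →
      ∫ s in a..b, (⟪p s, η' s⟫ - ⟪G s, η s⟫) = 0) {s₀ : ℝ} (hs₀ : s₀ ∈ Ioo α β) :
    HasDerivAt p (-G s₀) s₀ := by
  obtain ⟨a, ha1, ha2⟩ := exists_between hs₀.1
  obtain ⟨b, hb1, hb2⟩ := exists_between hs₀.2
  have hab : a < b := ha2.trans hb1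
  have haJ : a ∈ Ioo α β := ⟨ha1, hab.trans hb2⟩
  have hbJ : b ∈ Ioo α β := ⟨ha1.trans hab, hb2⟩
  have hprim : ∀ f : ℝ → E d, ContinuousOn f (Ioo α β) → ∀ s ∈ Ioo α β,
      HasDerivAt (fun s => ∫ r in a..s, f r) (f s) s := fun f hf s hs => by
    refine intervalIntegral.integral_hasDerivAt_right
      (hf.mono (ordConnected_Ioo.uIcc_subset haJ hs)).intervalIntegrable
      (hf.stronglyMeasurableAtFilter isOpen_Ioo s hs) (hf.continuousAt (isOpen_Ioo.mem_nhds hs))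
  set Γ : ℝ → E d := fun s => ∫ r in a..s, G r with hΓ
  have hΓd := hprim G hG
  have hR : ContinuousOn (fun s => p s + Γ s) (Ioo α β) :=
    hp.add (HasDerivAt.continuousOn hΓd)
  have hIcc : Icc a b ⊆ Ioo α β := ordConnected_Ioo.out haJ hbJ
  -- `k` is the mean of `p + Γ`, so that the primitive `η` of `p + Γ - k` also vanishes at `b` and
  -- is an admissible test function.
  set k : E d := (b - a)⁻¹ • ∫ r in a..b, (p r + Γ r) with hk
  have hRk : ContinuousOn (fun s => p s + Γ s - k) (Ioo α β) := hR.sub continuousOn_const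
  set η : ℝ → E d := fun s => ∫ r in a..s, (p r + Γ r - k) with hη
  have hηd := hprim _ hRk
  have hηa : η a = 0 := by simp [hη]
  have hηb : η b = 0 := by
    simp only [hη]
    rw [intervalIntegral.integral_sub
      (hR.mono (ordConnected_Ioo.uIcc_subset haJ hbJ)).intervalIntegrable intervalIntegrable_const,
      intervalIntegral.integral_const, hk, smul_smul, mul_inv_cancel₀ (sub_pos.2 hab).ne',
      one_smul, sub_self]
  have h0 := hweak a b haJ hbJ hab η _ (fun s hs => hηd s (hIcc hs)) (hRk.mono hIcc) hηa hηb
  have hηc : ContinuousOn η (Icc a b) := HasDerivAt.continuousOn fun s hs => hηd s (hIcc hs)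
  have hΓc : ContinuousOn Γ (Icc a b) := HasDerivAt.continuousOn fun s hs => hΓd s (hIcc hs)
  have hRkc := hRk.mono hIcc
  have hpc := hp.mono hIcc
  have hGc := hG.mono hIcc
  have hu' := uIcc_of_le hab.le
  -- Integration by parts: the integrand is the derivative of `⟪Γ - k, η⟫`, which vanishes at both
  -- ends. Adding the weak equation leaves `∫ ‖p + Γ - k‖ ^ 2 = 0`.
  have h1 : ∫ s in a..b, (⟪Γ s - k, p s + Γ s - k⟫ + ⟪G s, η s⟫) = 0 := by
    have hd : ∀ s ∈ uIcc a b, HasDerivAt (fun s => ⟪Γ s - k, η s⟫)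
        (⟪Γ s - k, p s + Γ s - k⟫ + ⟪G s, η s⟫) s := fun s hs => by
      rw [hu'] at hs
      exact ((hΓd s (hIcc hs)).sub_const k).inner ℝ (hηd s (hIcc hs))
    rw [intervalIntegral.integral_eq_sub_of_hasDerivAt hd, hηa, hηb]
    · simp
    · refine ContinuousOn.intervalIntegrable ?_
      rw [hu']
      exact ((hΓc.sub continuousOn_const).inner hRkc).add (hGc.inner hηc)
  have h2 : ∫ s in a..b, ‖p s + Γ s - k‖ ^ 2 = 0 := by
    rw [← add_zero (0 : ℝ)]
    nth_rewrite 1 [← h0]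
    rw [← h1, ← intervalIntegral.integral_add]
    · refine intervalIntegral.integral_congr fun s _ => ?_
      have : p s + Γ s - k = p s + (Γ s - k) := by abel
      simp only [← real_inner_self_eq_norm_sq]
      nth_rewrite 1 [this]
      rw [inner_add_left]
      ring
    · refine ContinuousOn.intervalIntegrable ?_
      rw [hu']
      exact (hpc.inner hRkc).sub (hGc.inner hηc)
    · refine ContinuousOn.intervalIntegrable ?_
      rw [hu']
      exact ((hΓc.sub continuousOn_const).inner hRkc).add (hGc.inner hηc)
  have h3 : ∀ s ∈ Icc a b, p s = k - Γ s := by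
    intro s hs
    by_contra hne
    have hpos := intervalIntegral.integral_pos hab (f := fun s => ‖p s + Γ s - k‖ ^ 2)
      (hRkc.norm.pow 2) (fun _ _ => by positivity) ⟨s, hs, by
        have : p s + Γ s - k ≠ 0 := fun h => hne (eq_sub_of_add_eq (sub_eq_zero.1 h))
        positivity⟩
    exact hpos.ne' h2
  exact ((hΓd s₀ hs₀).const_sub k).congr_of_eventuallyEq
    (Filter.eventuallyEq_of_mem (Icc_mem_nhds ha2 hb1) h3)

section Characteristics

variable (hH : IsConvexHamiltonian H m M) (hu : IsC1Solution H t₀ t₁ u)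
include hH hu

/-- The lift of a characteristic curve to the graph of the gradient is an orbit. -/
theorem hasDerivAt_spaceGrad {c : ℝ → E d} {α β : ℝ} (hI : Ioo α β ⊆ timeInterval t₀ t₁)
    (hc : ∀ s ∈ Ioo α β, HasDerivAt c (gradP H s (c s, spaceGrad u (s, c s))) s)
    {s : ℝ} (hs : s ∈ Ioo α β) : HasDerivAt (fun s => spaceGrad u (s, c s))
      (-gradQ H s (c s, spaceGrad u (s, c s))) s := by
  have hcc : ContinuousOn c (Ioo α β) := HasDerivAt.continuousOn hc
  have hP : ContinuousOn (fun s => spaceGrad u (s, c s)) (Ioo α β) :=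
    hu.continuousOn_spaceGrad.comp (continuousOn_id.prodMk hcc) fun s hs => ⟨hI hs, mem_univ _⟩
  have hgQ : ContinuousOn (fun s => gradQ H s (c s, spaceGrad u (s, c s))) (Ioo α β) :=
    hH.contDiff_gradQ.continuous.comp_continuousOn (continuousOn_id.prodMk (hcc.prodMk hP))
  refine hasDerivAt_of_forall_integral_eq_zero hP hgQ ?_ hs
  intro a b ha hb hab η η' hη hη' hηa hηb
  have hIcc : Icc a b ⊆ Ioo α β := ordConnected_Ioo.out ha hb
  have hηc : ContinuousOn η (Icc a b) := HasDerivAt.continuousOn hη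
  obtain ⟨B, hB⟩ := isCompact_Icc.exists_bound_of_continuousOn ((hηc.norm.pow 2).add
    (hη'.norm.pow 2))
  -- Since `η` vanishes at both ends, the increments of `u` cancel; as `ε` takes both signs, the
  -- linear term must be zero.
  refine eq_zero_of_forall_nonneg_add (K := (M + (M ^ 2 + 1) / m) * B * (b - a)) fun ε => ?_
  have := perturbation_le hH hu (hI ha) (hI hb) hab.le (η := fun s => ε • η s)
    (η' := fun s => ε • η' s) (B := ε ^ 2 * B) (fun s hs => hc s (hIcc hs))
    (fun s hs => (hη s hs).const_smul ε) (hη'.const_smul ε) fun s hs => by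
      have h1 := (le_abs_self _).trans (hB s hs)
      rw [norm_smul, norm_smul, mul_pow, mul_pow, Real.norm_eq_abs, sq_abs, ← mul_add]
      exact mul_le_mul_of_nonneg_left h1 (sq_nonneg ε)
  simp only [hηa, hηb, smul_zero, add_zero, real_inner_smul_right, ← mul_sub,
    intervalIntegral.integral_const_mul] at this
  linarith

/-- Orbits starting on the graph of the gradient of a `C¹` solution stay on it. -/
theorem graph_invariant {x : ℝ → E d × E d} (hx : IsOrbit H x) {t : ℝ}
    (ht : t ∈ timeInterval t₀ t₁) (hxt : (x t).2 = spaceGrad u (t, (x t).1)) :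
    ∀ s ∈ timeInterval t₀ t₁, (x s).2 = spaceGrad u (s, (x s).1) := by
  set S : Set ℝ := {s | s ∈ timeInterval t₀ t₁ ∧ (x s).2 = spaceGrad u (s, (x s).1)} with hS
  have hopen : IsOpen S := by
    rw [isOpen_iff_mem_nhds]
    rintro s ⟨hs, hxs⟩
    have hf : ContinuousOn (fun z : ℝ × E d => gradP H z.1 (z.2, spaceGrad u z))
        (timeInterval t₀ t₁ ×ˢ univ) :=
      hH.contDiff_gradP.continuous.comp_continuousOn (continuousOn_fst.prodMk
        (continuousOn_snd.prodMk hu.continuousOn_spaceGrad))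
    obtain ⟨c, hc0, hc⟩ := exists_eventually_hasDerivAt_of_continuousOn isOpen_timeInterval_prod
      hf (t₀ := s) (x₀ := (x s).1) ⟨hs, mem_univ _⟩
    obtain ⟨ε, hε, hball⟩ := Metric.eventually_nhds_iff_ball.1 hc
    rw [Real.ball_eq_Ioo] at hball
    have hmem : Ioo (s - ε) (s + ε) ∈ 𝓝 s := Ioo_mem_nhds (by linarith) (by linarith)
    have horb : ∀ r ∈ Ioo (s - ε) (s + ε), HasDerivAt (fun r => (c r, spaceGrad u (r, c r)))
        (vecField H r (c r, spaceGrad u (r, c r))) r := fun r hr =>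
      (hball r hr).2.prodMk (hasDerivAt_spaceGrad hH hu (fun r hr => (hball r hr).1.1)
        (fun r hr => (hball r hr).2) hr)
    -- Peano's theorem gives no uniqueness for `c`, but its lift solves the Lipschitz Hamiltonian
    -- system with the same data as `x`.
    have heq : x =ᶠ[𝓝 s] fun r => (c r, spaceGrad u (r, c r)) :=
      ODE_solution_unique_of_eventually (v := vecField H) (s := fun _ => univ)
        (Eventually.of_forall fun r => (hH.lipschitzWith_vecField r).lipschitzOnWith)
        (Eventually.of_forall fun r => ⟨hx r, mem_univ _⟩)
        (by filter_upwards [hmem] with r hr using ⟨horb r hr, mem_univ _⟩)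
        (Prod.ext hc0.symm (by simp only [hc0]; exact hxs))
    filter_upwards [heq, isOpen_timeInterval.mem_nhds hs] with r hr hrI
    refine ⟨hrI, ?_⟩
    rw [hr]
  have hsub := ordConnected_timeInterval.isPreconnected.subset_of_closure_inter_subset hopen
    ⟨t, ht, ht, hxt⟩ (by
      rintro r ⟨hr, hrI⟩
      refine ⟨hrI, ?_⟩
      refine tendsto_nhds_unique_of_frequently_eq
        (continuous_snd.comp hx.continuous).continuousAt
        (hu.continuousAt_spaceGrad_comp hrI (continuous_fst.comp hx.continuous).continuousAt) ?_
      exact (mem_closure_iff_frequently.1 hr).mono fun s hs => hs.2)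
  exact fun s hs => (hsub hs).2

/-- The orbit through a point of the graph of the gradient. -/
theorem exists_calibrated_orbit {t : ℝ} (ht : t ∈ timeInterval t₀ t₁) (q : E d) :
    ∃ x, IsOrbit H x ∧ (x t).1 = q ∧
      ∀ s ∈ timeInterval t₀ t₁, (x s).2 = spaceGrad u (s, (x s).1) := by
  obtain ⟨x, hx, hxt⟩ := hH.exists_isOrbit t (q, spaceGrad u (t, q))
  exact ⟨x, hx, by rw [hxt], graph_invariant hH hu hx ht (by simp [hxt])⟩

end Characteristics

/-! ### The Lax-Oleinik formulas and uniqueness. -/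

theorem sum_fin_succ_sub_castSucc (n : ℕ) (g : Fin (n + 1) → ℝ) :
    ∑ i : Fin n, (g i.succ - g i.castSucc) = g (Fin.last n) - g 0 := by
  have h1 := Fin.sum_univ_succ g
  have h2 := Fin.sum_univ_castSucc g
  rw [Finset.sum_sub_distrib]
  linarith

/-- Uniqueness of the joining orbit makes the choice in `genFun` immaterial. -/
theorem IsTwistTime.genFun_eq {σ : ℝ} (hσ : IsTwistTime H σ) {τ t : ℝ} (hτt : τ < t)
    (hle : t - τ ≤ σ) {x : ℝ → E d × E d} (hx : IsOrbit H x) :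
    genFun H τ t (x τ).1 (x t).1 = action H τ t x := by
  have hex : ∃ y, IsJoiningOrbit H τ t (x τ).1 (x t).1 y := ⟨x, hx, rfl, rfl⟩
  rw [genFun, dif_pos hex]
  congr 1
  exact (hσ.2 τ t hτt hle _ _).unique hex.choose_spec ⟨hx, rfl, rfl⟩

section LaxOleinik

variable (hH : IsConvexHamiltonian H m M) (hu : IsC1Solution H t₀ t₁ u)
include hH hu

theorem sub_le_genFun {σ : ℝ} (hσ : IsTwistTime H σ) {τ t : ℝ} (hτ : τ ∈ timeInterval t₀ t₁)
    (ht : t ∈ timeInterval t₀ t₁) (hτt : τ < t) (hle : t - τ ≤ σ) (q₀ q₁ : E d) :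
    u t q₁ - u τ q₀ ≤ genFun H τ t q₀ q₁ := by
  obtain ⟨x, ⟨hx, rfl, rfl⟩, -⟩ := hσ.2 τ t hτt hle q₀ q₁
  rw [hσ.genFun_eq hτt hle hx]
  exact sub_le_action hH hu hx hτ ht hτt.le

omit hH hu in
theorem node_mem {τ t : ℝ} (hτ : τ ∈ timeInterval t₀ t₁) (ht : t ∈ timeInterval t₀ t₁)
    (hτt : τ ≤ t) {n : ℕ} (hn : 0 < n) {r : ℝ} (hr0 : 0 ≤ r) (hrn : r ≤ n) :
    τ + r * ((t - τ) / n) ∈ timeInterval t₀ t₁ := by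
  have hn' : (0 : ℝ) < n := by exact_mod_cast hn
  have h0 : 0 ≤ (t - τ) / n := div_nonneg (sub_nonneg.2 hτt) hn'.le
  refine ordConnected_timeInterval.out hτ ht ⟨by linarith [mul_nonneg hr0 h0], ?_⟩
  have := mul_le_mul_of_nonneg_right hrn h0
  rw [mul_div_cancel₀ _ hn'.ne'] at this
  linarith

omit hH hu in
theorem sum_increments {τ t : ℝ} {n : ℕ} (hn : 0 < n) (θ : Fin (n + 1) → E d) :
    ∑ i : Fin n, (u (τ + ((i : ℝ) + 1) * ((t - τ) / n)) (θ i.succ) -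
      u (τ + (i : ℝ) * ((t - τ) / n)) (θ i.castSucc)) = u t (θ (Fin.last n)) - u τ (θ 0) := by
  have hn' : (n : ℝ) ≠ 0 := by exact_mod_cast hn.ne'
  have h := sum_fin_succ_sub_castSucc n fun i => u (τ + ((i : ℕ) : ℝ) * ((t - τ) / n)) (θ i)
  simp only [Fin.val_succ, Nat.cast_add, Nat.cast_one, Fin.val_castSucc, Fin.val_last,
    Fin.coe_ofNat_eq_mod, Nat.zero_mod, Nat.cast_zero, zero_mul, add_zero,
    mul_div_cancel₀ _ hn', add_sub_cancel] at h
  exact h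

/-- Domination holds on each step of the subdivision, and the increments of `u` telescope for every
choice of intermediate points. -/
theorem sub_le_minAction {σ : ℝ} (hσ : IsTwistTime H σ) {τ t : ℝ} (hτ : τ ∈ timeInterval t₀ t₁)
    (ht : t ∈ timeInterval t₀ t₁) (hτt : τ < t) {n : ℕ} (hn : 0 < n) (hlt : (t - τ) / n < σ)
    (q₀ q₁ : E d) : ((u t q₁ - u τ q₀ : ℝ) : EReal) ≤ minAction H n τ t q₀ q₁ := by
  refine le_iInf ?_
  rintro ⟨θ, rfl, rfl⟩
  rw [EReal.coe_le_coe_iff, ← sum_increments hn, brokenAction]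
  have hn' : (0 : ℝ) < n := by exact_mod_cast hn
  have h0 : 0 < (t - τ) / n := div_pos (sub_pos.2 hτt) hn'
  refine Finset.sum_le_sum fun i _ => ?_
  have hi : ((i : ℕ) : ℝ) + 1 ≤ n := by exact_mod_cast i.2
  have hi0 : (0 : ℝ) ≤ ((i : ℕ) : ℝ) := Nat.cast_nonneg _
  exact sub_le_genFun hH hu hσ (node_mem hτ ht hτt.le hn hi0 (by linarith))
    (node_mem hτ ht hτt.le hn (by linarith) hi) (by linarith) (by linarith) _ _

/-- The positions of the calibrated orbit at the nodes are competitors, and each of their steps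
realises equality in the domination. -/
theorem minAction_le_sub {σ : ℝ} (hσ : IsTwistTime H σ) {τ t : ℝ} (hτ : τ ∈ timeInterval t₀ t₁)
    (ht : t ∈ timeInterval t₀ t₁) (hτt : τ < t) {n : ℕ} (hn : 0 < n) (hlt : (t - τ) / n < σ)
    {x : ℝ → E d × E d} (hx : IsOrbit H x)
    (hgraph : ∀ s ∈ timeInterval t₀ t₁, (x s).2 = spaceGrad u (s, (x s).1)) :
    minAction H n τ t (x τ).1 (x t).1 ≤ ((u t (x t).1 - u τ (x τ).1 : ℝ) : EReal) := by
  have hn' : (0 : ℝ) < n := by exact_mod_cast hn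
  have h0 : 0 < (t - τ) / n := div_pos (sub_pos.2 hτt) hn'
  have hfirst : τ + (((0 : Fin (n + 1)) : ℕ) : ℝ) * ((t - τ) / n) = τ := by simp
  have hlast : τ + ((Fin.last n : ℕ) : ℝ) * ((t - τ) / n) = t := by
    rw [Fin.val_last, mul_div_cancel₀ _ hn'.ne']; ring
  refine iInf_le_of_le ⟨fun i => (x (τ + ((i : ℕ) : ℝ) * ((t - τ) / n))).1,
    by simp only [hfirst], by simp only [hlast]⟩ (le_of_eq ?_)
  rw [EReal.coe_eq_coe_iff, brokenAction]
  have h := sum_increments (u := u) (τ := τ) (t := t) hn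
    (fun i => (x (τ + ((i : ℕ) : ℝ) * ((t - τ) / n))).1)
  simp only [hfirst, hlast] at h
  rw [← h]
  refine Finset.sum_congr rfl fun i _ => ?_
  have hi : ((i : ℕ) : ℝ) + 1 ≤ n := by exact_mod_cast i.2
  have hi0 : (0 : ℝ) ≤ ((i : ℕ) : ℝ) := Nat.cast_nonneg _
  simp only [Fin.val_succ, Nat.cast_add, Nat.cast_one, Fin.val_castSucc]
  rw [hσ.genFun_eq (by linarith) (by linarith) hx]
  exact action_eq_sub hH hu hx (node_mem hτ ht hτt.le hn hi0 (by linarith))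
    (node_mem hτ ht hτt.le hn (by linarith) hi) (by linarith) hgraph

theorem laxOleinik_eq {σ : ℝ} (hσ : IsTwistTime H σ) {τ t : ℝ} (hτ : τ ∈ timeInterval t₀ t₁)
    (ht : t ∈ timeInterval t₀ t₁) (hτt : τ ≤ t) {n : ℕ} (hn : 0 < n) (hlt : (t - τ) / n < σ)
    (q : E d) : laxOleinik H n τ t (u τ) q = (u t q : EReal) := by
  rw [laxOleinik]
  rcases hτt.eq_or_lt with rfl | hτt
  · simp
  rw [if_neg hτt.ne]
  refine le_antisymm ?_ (le_iInf fun θ => ?_)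
  -- The optimal `θ` is the position at time `τ` of the calibrated orbit that reaches `q` at time
  -- `t`.
  · obtain ⟨x, hx, rfl, hgraph⟩ := exists_calibrated_orbit hH hu ht q
    refine iInf_le_of_le (x τ).1 ((add_le_add le_rfl
      (minAction_le_sub hH hu hσ hτ ht hτt hn hlt hx hgraph)).trans ?_)
    rw [← EReal.coe_add, add_sub_cancel]
  · refine le_trans ?_ (add_le_add le_rfl (sub_le_minAction hH hu hσ hτ ht hτt hn hlt θ q))
    rw [← EReal.coe_add, add_sub_cancel]

theorem dualLaxOleinik_eq {σ : ℝ} (hσ : IsTwistTime H σ) {τ t : ℝ}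
    (hτ : τ ∈ timeInterval t₀ t₁) (ht : t ∈ timeInterval t₀ t₁) (hτt : τ ≤ t) {n : ℕ}
    (hn : 0 < n) (hlt : (t - τ) / n < σ) (q : E d) :
    dualLaxOleinik H n τ t (u t) q = (u τ q : EReal) := by
  rw [dualLaxOleinik]
  rcases hτt.eq_or_lt with rfl | hτt
  · simp
  rw [if_neg hτt.ne]
  refine le_antisymm (iSup_le fun θ => ?_) ?_
  · refine (EReal.sub_le_sub le_rfl (sub_le_minAction hH hu hσ hτ ht hτt hn hlt q θ)).trans ?_
    rw [← EReal.coe_sub, sub_sub_cancel]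
  · obtain ⟨x, hx, rfl, hgraph⟩ := exists_calibrated_orbit hH hu hτ q
    refine le_iSup_of_le (x t).1 (le_trans ?_ (EReal.sub_le_sub le_rfl
      (minAction_le_sub hH hu hσ hτ ht hτt hn hlt hx hgraph)))
    rw [← EReal.coe_sub, sub_sub_cancel]

/-- Both solutions are images of the same function, under `laxOleinik` for later times and
`dualLaxOleinik` for earlier ones. -/
theorem eq_of_eq_at {v : ℝ → E d → ℝ} (hv : IsC1Solution H t₀ t₁ v) {τ t : ℝ}
    (hτ : τ ∈ timeInterval t₀ t₁) (ht : t ∈ timeInterval t₀ t₁) (h : u τ = v τ) (q : E d) :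
    u t q = v t q := by
  obtain ⟨σ, hσ⟩ := hH.exists_isTwistTime
  obtain ⟨n, hn⟩ := exists_nat_gt (|t - τ| / σ)
  have hn' : (0 : ℝ) < n := (div_nonneg (abs_nonneg _) hσ.1.le).trans_lt hn
  have hn0 : 0 < n := by exact_mod_cast hn'
  rw [div_lt_iff₀ hσ.1] at hn
  rw [← EReal.coe_eq_coe_iff]
  rcases le_total τ t with hle | hle
  · have hlt : (t - τ) / n < σ := by
      rw [div_lt_iff₀ hn', mul_comm]
      exact (le_abs_self _).trans_lt hn
    rw [← laxOleinik_eq hH hu hσ hτ ht hle hn0 hlt, ← laxOleinik_eq hH hv hσ hτ ht hle hn0 hlt, h]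
  · have hlt : (τ - t) / n < σ := by
      rw [div_lt_iff₀ hn', mul_comm]
      rw [abs_sub_comm] at hn
      exact (le_abs_self _).trans_lt hn
    rw [← dualLaxOleinik_eq hH hu hσ ht hτ hle hn0 hlt,
      ← dualLaxOleinik_eq hH hv hσ ht hτ hle hn0 hlt, h]

end LaxOleinik

/-! ### Local `C^{1,1}` regularity. -/

/-- A map whose first order expansions have a uniform quadratic error has a Lipschitz gradient. -/
theorem norm_sub_le_of_quadratic_error {f : E d → ℝ} {P : E d → E d} {C : ℝ}
    (h : ∀ q w, |f (q + w) - f q - ⟪P q, w⟫| ≤ C * ‖w‖ ^ 2) (q q' : E d) :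
    ‖P q' - P q‖ ≤ 6 * C * ‖q' - q‖ := by
  set r := q' - q with hr
  set D := P q' - P q with hD
  have hq' : q + r = q' := by simp [hr]
  rcases eq_or_ne r 0 with h0 | h0
  · have : q' = q := sub_eq_zero.1 h0
    simp [hD, h0, this]
  have hrpos : 0 < ‖r‖ := norm_pos_iff.2 h0
  have hC : 0 ≤ C := nonneg_of_mul_nonneg_left ((abs_nonneg _).trans (h q r)) (by positivity)
  rcases eq_or_ne D 0 with hD0 | hD0
  · rw [hD0, norm_zero]; positivity
  have hDpos : 0 < ‖D‖ := norm_pos_iff.2 hD0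
  -- `w` has the length of `r` and the direction of `D`. Expanding `f` at `q + r + w` from `q` and
  -- through `q'` isolates `⟪D, w⟫`, with errors `4C‖r‖²`, `C‖r‖²` and `C‖r‖²`: hence the factor
  -- `6`.
  set w := (‖r‖ / ‖D‖) • D with hw
  have hwn : ‖w‖ = ‖r‖ := by
    rw [hw, norm_smul, Real.norm_of_nonneg (by positivity), div_mul_cancel₀ _ hDpos.ne']
  have hDw : ⟪D, w⟫ = ‖r‖ * ‖D‖ := by
    rw [hw, real_inner_smul_right, real_inner_self_eq_norm_mul_norm]
    field_simp
  have h1 := (abs_le.1 (h q (r + w))).2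
  have h2 := (abs_le.1 (h q' w)).1
  have h3 := (abs_le.1 (h q r)).1
  rw [← add_assoc, hq'] at h1
  rw [hq'] at h3
  have h4 : ‖r + w‖ ^ 2 ≤ (2 * ‖r‖) ^ 2 :=
    pow_le_pow_left₀ (norm_nonneg _) ((norm_add_le _ _).trans (by rw [hwn]; linarith)) 2
  have h5 := mul_le_mul_of_nonneg_left h4 hC
  rw [hwn] at h2
  rw [inner_add_right] at h1
  rw [hD, inner_sub_left] at hDw
  have h6 : ‖r‖ * ‖D‖ ≤ ‖r‖ * (6 * C * ‖r‖) := by nlinarith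
  exact le_of_mul_le_mul_left h6 hrpos

section Regularity

variable (hH : IsConvexHamiltonian H m M) (hu : IsC1Solution H t₀ t₁ u)
include hH hu

/-- Along an orbit `p' = -∂_qH`, so the linear term is the derivative of `⟪p, η⟫` and reduces to
boundary terms. -/
theorem perturbation_orbit_le {x : ℝ → E d × E d} (hx : IsOrbit H x)
    (hgraph : ∀ s ∈ timeInterval t₀ t₁, (x s).2 = spaceGrad u (s, (x s).1))
    {η η' : ℝ → E d} {a b B : ℝ} (ha : a ∈ timeInterval t₀ t₁)
    (hb : b ∈ timeInterval t₀ t₁) (hab : a ≤ b)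
    (hη : ∀ s, HasDerivAt η (η' s) s) (hη' : Continuous η')
    (hB : ∀ s ∈ Icc a b, ‖η s‖ ^ 2 + ‖η' s‖ ^ 2 ≤ B) :
    u b ((x b).1 + η b) - u a ((x a).1 + η a) ≤ u b (x b).1 - u a (x a).1 +
      (⟪(x b).2, η b⟫ - ⟪(x a).2, η a⟫) + (M + (M ^ 2 + 1) / m) * B * (b - a) := by
  have hg : ∀ s ∈ Icc a b, spaceGrad u (s, (x s).1) = (x s).2 := fun s hs =>
    (hgraph s (ordConnected_timeInterval.out ha hb hs)).symm
  have h := perturbation_le hH hu ha hb hab (c := fun s => (x s).1) (fun s hs => by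
    rw [hg s hs]; exact hx.hasDerivAt_fst s) (fun s _ => hη s) hη'.continuousOn hB
  have hd : ∀ s ∈ uIcc a b, HasDerivAt (fun s => ⟪(x s).2, η s⟫)
      (⟪(x s).2, η' s⟫ + ⟪-gradQ H s (x s), η s⟫) s := fun s _ =>
    (hx.hasDerivAt_snd s).inner ℝ (hη s)
  have hηc : Continuous η := continuous_iff_continuousAt.2 fun s => (hη s).continuousAt
  have hparts := intervalIntegral.integral_eq_sub_of_hasDerivAt hd (by
    refine Continuous.intervalIntegrable ?_ _ _
    exact ((continuous_snd.comp hx.continuous).inner hη').add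
      ((hH.contDiff_gradQ.continuous.comp (continuous_id.prodMk hx.continuous)).neg.inner hηc))
  have hcongr : ∫ s in a..b, (⟪spaceGrad u (s, (x s).1), η' s⟫ -
      ⟪gradQ H s ((x s).1, spaceGrad u (s, (x s).1)), η s⟫) =
      ∫ s in a..b, (⟪(x s).2, η' s⟫ + ⟪-gradQ H s (x s), η s⟫) := by
    refine intervalIntegral.integral_congr fun s hs => ?_
    rw [uIcc_of_le hab] at hs
    simp only [hg s hs, inner_neg_left, sub_eq_add_neg]
  rwa [hcongr, hparts] at h

/-- A ramp growing from `0` at `t - h` to `w` at `t` gives the upper bound; one decreasing from `w`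
at `t` to `0` at `t + h` gives the lower bound. The slope `h⁻¹` accounts for the constant. -/
theorem abs_sub_sub_inner_le {t h : ℝ} (hh : 0 < h) (ht₁ : t - h ∈ timeInterval t₀ t₁)
    (ht₂ : t + h ∈ timeInterval t₀ t₁) (q w : E d) :
    |u t (q + w) - u t q - ⟪spaceGrad u (t, q), w⟫| ≤
      (M + (M ^ 2 + 1) / m) * (1 + (h⁻¹) ^ 2) * h * ‖w‖ ^ 2 := by
  have ht : t ∈ timeInterval t₀ t₁ :=
    ordConnected_timeInterval.out ht₁ ht₂ ⟨by linarith, by linarith⟩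
  obtain ⟨x, hx, rfl, hgraph⟩ := exists_calibrated_orbit hH hu ht q
  have hramp : ∀ k : ℝ, ∀ s, HasDerivAt (fun s : ℝ => (1 + k * (s - t)) • w) (k • w) s :=
    fun k s => by
      have h1 : HasDerivAt (fun s : ℝ => 1 + k * (s - t)) k s := by
        simpa using (((hasDerivAt_id s).sub_const t).const_mul k).const_add 1
      exact h1.smul_const w
  have hbound : ∀ k l : ℝ, 0 ≤ l → l ≤ 1 → |k| = h⁻¹ →
      ‖l • w‖ ^ 2 + ‖k • w‖ ^ 2 ≤ (1 + (h⁻¹) ^ 2) * ‖w‖ ^ 2 := fun k l h0 h1 hk => by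
    rw [norm_smul, norm_smul, mul_pow, mul_pow, Real.norm_eq_abs, Real.norm_eq_abs, hk,
      abs_of_nonneg h0, ← add_mul]
    refine mul_le_mul_of_nonneg_right (add_le_add ?_ le_rfl) (sq_nonneg _)
    exact pow_le_one₀ h0 h1
  have hinv : h⁻¹ * h = 1 := inv_mul_cancel₀ hh.ne'
  have hinv0 : 0 < h⁻¹ := inv_pos.2 hh
  have hup := perturbation_orbit_le hH hu hx hgraph ht₁ ht (by linarith)
    (B := (1 + (h⁻¹) ^ 2) * ‖w‖ ^ 2) (hramp h⁻¹) continuous_const (fun s hs =>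
      hbound _ _ (by nlinarith [hs.1]) (by nlinarith [hs.2]) (abs_of_pos hinv0))
  have hlow := perturbation_orbit_le hH hu hx hgraph ht ht₂ (by linarith)
    (B := (1 + (h⁻¹) ^ 2) * ‖w‖ ^ 2) (hramp (-h⁻¹)) continuous_const (fun s hs =>
      hbound _ _ (by nlinarith [hs.2]) (by nlinarith [hs.1]) (by rw [abs_neg, abs_of_pos hinv0]))
  have e1 : 1 + h⁻¹ * (t - h - t) = 0 := by linarith
  have e2 : 1 + -h⁻¹ * h = 0 := by linarith
  simp only [e1, e2, sub_self, mul_zero, add_zero, one_smul, zero_smul, inner_zero_right, sub_zero,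
    sub_sub_cancel, add_sub_cancel_left] at hup hlow
  rw [← hgraph t ht, abs_le]
  constructor <;> linarith

theorem exists_spaceGrad_lipschitz_space {t : ℝ} (ht : t ∈ timeInterval t₀ t₁) :
    ∃ h > 0, ∃ L ≥ 0, ∀ s, |s - t| ≤ h → s ∈ timeInterval t₀ t₁ ∧
      ∀ q q', ‖spaceGrad u (s, q') - spaceGrad u (s, q)‖ ≤ L * ‖q' - q‖ := by
  obtain ⟨ε, hε, hball⟩ := Metric.isOpen_iff.1 isOpen_timeInterval t ht
  have hmem : ∀ r, |r - t| < ε → r ∈ timeInterval t₀ t₁ := fun r hr => hball (by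
    rwa [Metric.mem_ball, Real.dist_eq])
  have hm := hH.m_pos
  have hM := hH.M_nonneg
  -- With thirds, `s ± ε / 3` remains in the interval for every `s` considered, so one constant
  -- serves all these times.
  refine ⟨ε / 3, by positivity,
    6 * ((M + (M ^ 2 + 1) / m) * (1 + ((ε / 3)⁻¹) ^ 2) * (ε / 3)), by positivity, fun s hs => ?_⟩
  have hs' := abs_le.1 hs
  refine ⟨hmem s (hs.trans_lt (by linarith)), fun q q' => ?_⟩
  exact norm_sub_le_of_quadratic_error (f := u s) (P := fun q => spaceGrad u (s, q))
    (abs_sub_sub_inner_le hH hu (by positivity)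
      (hmem _ (abs_lt.2 ⟨by linarith, by linarith⟩))
      (hmem _ (abs_lt.2 ⟨by linarith, by linarith⟩))) q q'

omit hu in
/-- The displacement along an orbit is controlled by the vector field at the initial point. -/
theorem norm_orbit_displacement_le {x : ℝ → E d × E d} (hx : IsOrbit H x) {a b N l : ℝ}
    (hab : a ≤ b) (hl : b - a ≤ l) (hN : ∀ s ∈ Icc a b, ‖vecField H s (x a)‖ ≤ N) :
    ‖x b - x a‖ ≤ (N + M * gronwallBound 0 M N l) * (b - a) := by
  have hM := hH.M_nonneg
  have hN0 : 0 ≤ N := (norm_nonneg _).trans (hN a ⟨le_rfl, hab⟩)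
  -- Grönwall against the constant curve `x a`, which solves the system up to the error `N`.
  have hg := dist_le_of_approx_trajectories_ODE (v := vecField H) (f := x) (g := fun _ => x a)
    (f' := fun s => vecField H s (x s)) (g' := fun _ => 0) (a := a) (b := b) (εf := 0) (εg := N)
    (δ := 0) hH.lipschitzWith_vecField (HasDerivAt.continuousOn fun t _ => hx t)
    (fun t _ => (hx t).hasDerivWithinAt) (fun t _ => by simp) continuousOn_const
    (fun t _ => hasDerivWithinAt_const _ _ _)
    (fun t ht => by rw [dist_zero_left]; exact hN t ⟨ht.1, ht.2.le⟩) (by simp)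
  rw [Real.coe_toNNReal _ hM, zero_add] at hg
  have h := (convex_Icc a b).norm_image_sub_le_of_norm_hasDerivWithin_le
    (f := x) (C := N + M * gronwallBound 0 M N l) (x := a) (y := b)
    (fun r _ => (hx r).hasDerivWithinAt) (fun r hr => by
      have h1 : ‖x r - x a‖ ≤ gronwallBound 0 M N l := by
        rw [← dist_eq_norm]
        exact (hg r hr).trans (gronwallBound_mono le_rfl hN0 hM (by linarith [hr.2]))
      have h2 := (hH.norm_vecField_sub_le r (x r) (x a)).trans (mul_le_mul_of_nonneg_left h1 hM)
      calc ‖vecField H r (x r)‖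
          = ‖vecField H r (x a) + (vecField H r (x r) - vecField H r (x a))‖ := by simp
        _ ≤ _ := norm_add_le _ _
        _ ≤ _ := add_le_add (hN r hr) h2)
    ⟨le_rfl, hab⟩ ⟨hab, le_rfl⟩
  rwa [Real.norm_of_nonneg (sub_nonneg.2 hab)] at h

/-- The gradient of a `C¹` solution is locally Lipschitz in time and space. -/
theorem exists_spaceGrad_lipschitz {t : ℝ} (ht : t ∈ timeInterval t₀ t₁) (q : E d) :
    ∃ K ≥ 0, ∃ W ∈ 𝓝 (t, q), ∀ z ∈ W, ∀ z' ∈ W,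
      ‖spaceGrad u z - spaceGrad u z'‖ ≤ K * ‖z - z'‖ := by
  obtain ⟨h, hh, L, hL, hspace⟩ := exists_spaceGrad_lipschitz_space hH hu ht
  set T : Set ℝ := Metric.closedBall t h with hT
  have hTmem : ∀ s ∈ T, s ∈ timeInterval t₀ t₁ := fun s hs =>
    (hspace s (by rwa [hT, Metric.mem_closedBall, Real.dist_eq] at hs)).1
  have hTlip : ∀ s ∈ T, ∀ q q', ‖spaceGrad u (s, q') - spaceGrad u (s, q)‖ ≤ L * ‖q' - q‖ :=
    fun s hs => (hspace s (by rwa [hT, Metric.mem_closedBall, Real.dist_eq] at hs)).2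
  have hTcpt : IsCompact T := isCompact_closedBall t h
  have hBcpt : IsCompact (Metric.closedBall q 1) := isCompact_closedBall q 1
  have hcont : ContinuousOn (fun w : ℝ × ℝ × E d =>
      vecField H w.1 (w.2.2, spaceGrad u w.2)) (T ×ˢ T ×ˢ Metric.closedBall q 1) :=
    hH.contDiff_vecField.continuous.comp_continuousOn (continuousOn_fst.prodMk
      ((continuous_snd.comp continuous_snd).continuousOn.prodMk
        (hu.continuousOn_spaceGrad.comp continuousOn_snd
          fun w hw => ⟨hTmem _ hw.2.1, mem_univ _⟩)))
  obtain ⟨N, hN⟩ := (hTcpt.prod (hTcpt.prod hBcpt)).exists_bound_of_continuousOn hcont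
  have hN0 : 0 ≤ N := (norm_nonneg _).trans (hN (t, t, q)
    ⟨Metric.mem_closedBall_self hh.le, Metric.mem_closedBall_self hh.le,
      Metric.mem_closedBall_self zero_le_one⟩)
  set C := N + M * gronwallBound 0 M N (2 * h) with hC
  have hC0 : 0 ≤ C := by
    have h1 : 0 ≤ gronwallBound 0 M N (2 * h) := by
      have := gronwallBound_mono (δ := 0) le_rfl hN0 hH.M_nonneg (by positivity : 0 ≤ 2 * h)
      rwa [gronwallBound_x0] at this
    have := hH.M_nonneg
    positivity
  -- The orbit through the graph point above `(a, y)` reaches the graph at time `b` after a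
  -- displacement of at most `C * (b - a)`; the Lipschitz bound in space at time `b` brings the
  -- position back to `y`.
  have htime : ∀ a ∈ T, ∀ b ∈ T, a ≤ b → ∀ y ∈ Metric.closedBall q 1,
      ‖spaceGrad u (b, y) - spaceGrad u (a, y)‖ ≤ (L + 1) * C * |b - a| := by
    intro a ha b hb hab y hy
    obtain ⟨x, hx, rfl, hgraph⟩ := exists_calibrated_orbit hH hu (hTmem a ha) y
    have hba : b - a ≤ 2 * h := by
      have h1 := abs_le.1 (show |a - t| ≤ h by
        rwa [hT, Metric.mem_closedBall, Real.dist_eq] at ha)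
      have h2 := abs_le.1 (show |b - t| ≤ h by
        rwa [hT, Metric.mem_closedBall, Real.dist_eq] at hb)
      linarith
    have hdisp := norm_orbit_displacement_le hH hx hab hba (N := N) fun s hs => by
      have hsT : s ∈ T := (convex_closedBall t h).ordConnected.out ha hb hs
      have := hN (s, a, (x a).1) ⟨hsT, ha, hy⟩
      rwa [← hgraph a (hTmem a ha)] at this
    have h1 := hTlip b hb (x b).1 (x a).1
    rw [← hgraph b (hTmem b hb)] at h1
    rw [← hgraph a (hTmem a ha), abs_of_nonneg (sub_nonneg.2 hab)]
    have h2 : ‖(x a).1 - (x b).1‖ ≤ C * (b - a) := by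
      rw [norm_sub_rev]
      exact (norm_fst_le (x b - x a)).trans hdisp
    have h3 : ‖(x b).2 - (x a).2‖ ≤ C * (b - a) := (norm_snd_le (x b - x a)).trans hdisp
    calc ‖spaceGrad u (b, (x a).1) - (x a).2‖
        = ‖(spaceGrad u (b, (x a).1) - (x b).2) + ((x b).2 - (x a).2)‖ := by simp
      _ ≤ _ := norm_add_le _ _
      _ ≤ L * (C * (b - a)) + C * (b - a) :=
          add_le_add (h1.trans (mul_le_mul_of_nonneg_left h2 hL)) h3
      _ = _ := by ring
  refine ⟨L + (L + 1) * C, by positivity, T ×ˢ Metric.closedBall q 1,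
    prod_mem_nhds (Metric.closedBall_mem_nhds t hh) (Metric.closedBall_mem_nhds q one_pos), ?_⟩
  rintro ⟨a, y⟩ ⟨ha, hy⟩ ⟨b, y'⟩ ⟨hb, hy'⟩
  have ht' : ‖spaceGrad u (a, y') - spaceGrad u (b, y')‖ ≤ (L + 1) * C * |a - b| := by
    rcases le_total a b with hab | hab
    · rw [norm_sub_rev, abs_sub_comm]
      exact htime a ha b hb hab y' hy'
    · exact htime b hb a ha hab y' hy'
  have hs' := hTlip a ha y' y
  have n1 : ‖y - y'‖ ≤ ‖((a, y) : ℝ × E d) - (b, y')‖ := norm_snd_le (((a, y) : ℝ × E d) - (b, y'))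
  have n2 : |a - b| ≤ ‖((a, y) : ℝ × E d) - (b, y')‖ := norm_fst_le (((a, y) : ℝ × E d) - (b, y'))
  calc ‖spaceGrad u (a, y) - spaceGrad u (b, y')‖
      = ‖(spaceGrad u (a, y) - spaceGrad u (a, y')) +
          (spaceGrad u (a, y') - spaceGrad u (b, y'))‖ := by simp
    _ ≤ _ := norm_add_le _ _
    _ ≤ L * ‖((a, y) : ℝ × E d) - (b, y')‖ + (L + 1) * C * ‖((a, y) : ℝ × E d) - (b, y')‖ :=
        add_le_add (hs'.trans (mul_le_mul_of_nonneg_left n1 hL))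
          (ht'.trans (mul_le_mul_of_nonneg_left n2 (by positivity)))
    _ = _ := by ring

/-- The differential has components `-H(t, q, ∂_q u)` and `∂_q u`, and `H` is locally Lipschitz. -/
theorem isLocallyC11On :
    IsLocallyC11On (fun z : ℝ × E d => u z.1 z.2) (timeInterval t₀ t₁ ×ˢ univ) := by
  refine ⟨hu.1.differentiableOn (by norm_num), ?_⟩
  rintro ⟨t, q⟩ ⟨ht, -⟩
  obtain ⟨K, hK0, W, hW, hK⟩ := exists_spaceGrad_lipschitz hH hu ht q
  obtain ⟨K', V, hV, hK'⟩ :=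
    (hH.contDiff.of_le (by norm_num : (1 : WithTop ℕ∞) ≤ 2)).locallyLipschitz
      (t, q, spaceGrad u (t, q))
  have hVW : ∀ᶠ z in 𝓝 (t, q), (z.1, z.2, spaceGrad u z) ∈ V :=
    (continuousAt_fst.prodMk (continuousAt_snd.prodMk (hu.continuousAt_spaceGrad ht q))) hV
  have hI : timeInterval t₀ t₁ ×ˢ (univ : Set (E d)) ∈ 𝓝 (t, q) :=
    isOpen_timeInterval_prod.mem_nhds ⟨ht, mem_univ q⟩
  refine ⟨(K + K' * (1 + K)).toNNReal, _,
    mem_nhdsWithin_of_mem_nhds (inter_mem (inter_mem hW hVW) hI),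
    LipschitzOnWith.of_dist_le_mul ?_⟩
  rintro ⟨a, y⟩ ⟨⟨hzW, hzV⟩, hzI, -⟩ ⟨b, y'⟩ ⟨⟨hzW', hzV'⟩, hzI', -⟩
  rw [dist_eq_norm, dist_eq_norm, Real.coe_toNNReal _ (by positivity)]
  have hP := hK _ hzW _ hzW'
  set D : ℝ := ‖((a, y) : ℝ × E d) - (b, y')‖ with hD
  have hD0 : 0 ≤ D := norm_nonneg _
  have hHd : |H a y (spaceGrad u (a, y)) - H b y' (spaceGrad u (b, y'))| ≤
      K' * ((1 + K) * D) := by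
    have h1 := hK'.dist_le_mul _ hzV _ hzV'
    rw [Real.dist_eq, dist_eq_norm] at h1
    refine h1.trans (mul_le_mul_of_nonneg_left ?_ K'.2)
    have n1 : ‖y - y'‖ ≤ D := norm_snd_le (((a, y) : ℝ × E d) - (b, y'))
    have n2 : ‖a - b‖ ≤ D := norm_fst_le (((a, y) : ℝ × E d) - (b, y'))
    have n3 : D ≤ (1 + K) * D := by nlinarith
    have n4 : K * D ≤ (1 + K) * D := by nlinarith
    exact max_le (n2.trans n3) (max_le (n1.trans n3) (hP.trans n4))
  refine ContinuousLinearMap.opNorm_le_bound _ (by positivity) fun ⟨l, w⟩ => ?_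
  rw [sub_apply, hu.fderiv_apply hzI, hu.fderiv_apply hzI']
  have n1 : ‖w‖ ≤ ‖((l, w) : ℝ × E d)‖ := norm_snd_le ((l, w) : ℝ × E d)
  have n2 : |l| ≤ ‖((l, w) : ℝ × E d)‖ := norm_fst_le ((l, w) : ℝ × E d)
  have e : ⟪spaceGrad u (a, y), w⟫ - l * H a y (spaceGrad u (a, y)) -
      (⟪spaceGrad u (b, y'), w⟫ - l * H b y' (spaceGrad u (b, y'))) =
      ⟪spaceGrad u (a, y) - spaceGrad u (b, y'), w⟫ -
      l * (H a y (spaceGrad u (a, y)) - H b y' (spaceGrad u (b, y'))) := by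
    rw [inner_sub_left]; ring
  rw [e, Real.norm_eq_abs]
  calc |⟪spaceGrad u (a, y) - spaceGrad u (b, y'), w⟫ -
        l * (H a y (spaceGrad u (a, y)) - H b y' (spaceGrad u (b, y')))|
      ≤ |⟪spaceGrad u (a, y) - spaceGrad u (b, y'), w⟫| +
        |l * (H a y (spaceGrad u (a, y)) - H b y' (spaceGrad u (b, y')))| := abs_sub _ _
    _ ≤ K * D * ‖((l, w) : ℝ × E d)‖ + ‖((l, w) : ℝ × E d)‖ * (K' * ((1 + K) * D)) := by
        refine add_le_add ?_ ?_
        · exact (abs_real_inner_le_norm _ _).trans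
            (mul_le_mul hP n1 (norm_nonneg _) (by positivity))
        · rw [abs_mul]
          exact mul_le_mul n2 hHd (abs_nonneg _) (norm_nonneg _)
    _ = _ := by ring

end Regularity

end HamiltonJacobi

theorem mainTheorem5 {d : ℕ} (H : ℝ → HamiltonJacobi.E d → HamiltonJacobi.E d → ℝ) (m M : ℝ)
    (hH : HamiltonJacobi.IsConvexHamiltonian H m M) :
    (∃ σ : ℝ, HamiltonJacobi.IsTwistTime H σ) ∧
    ∀ t₀ t₁ : EReal,
      (∀ u : ℝ → HamiltonJacobi.E d → ℝ, HamiltonJacobi.IsC1Solution H t₀ t₁ u →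
        (∀ σ : ℝ, HamiltonJacobi.IsTwistTime H σ →
          ∀ τ ∈ HamiltonJacobi.timeInterval t₀ t₁, ∀ t ∈ HamiltonJacobi.timeInterval t₀ t₁,
            τ ≤ t → ∀ n : ℕ, 0 < n → (t - τ) / n < σ → ∀ q : HamiltonJacobi.E d,
              HamiltonJacobi.laxOleinik H n τ t (u τ) q = (u t q : EReal) ∧
              HamiltonJacobi.dualLaxOleinik H n τ t (u t) q = (u τ q : EReal)) ∧
        HamiltonJacobi.IsLocallyC11On (fun z : ℝ × HamiltonJacobi.E d => u z.1 z.2)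
          (HamiltonJacobi.timeInterval t₀ t₁ ×ˢ Set.univ)) ∧
      (∀ u v : ℝ → HamiltonJacobi.E d → ℝ, HamiltonJacobi.IsC1Solution H t₀ t₁ u →
        HamiltonJacobi.IsC1Solution H t₀ t₁ v →
        ∀ τ ∈ HamiltonJacobi.timeInterval t₀ t₁, (∀ q, u τ q = v τ q) →
          ∀ t ∈ HamiltonJacobi.timeInterval t₀ t₁, ∀ q, u t q = v t q) := by
  refine ⟨hH.exists_isTwistTime, fun t₀ t₁ => ⟨fun u hu => ⟨?_, ?_⟩, ?_⟩⟩
  · intro σ hσ τ hτ t ht hτt n hn hlt q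
    exact ⟨HamiltonJacobi.laxOleinik_eq hH hu hσ hτ ht hτt hn hlt q,
      HamiltonJacobi.dualLaxOleinik_eq hH hu hσ hτ ht hτt hn hlt q⟩
  · exact HamiltonJacobi.isLocallyC11On hH hu
  · intro u v hu hv τ hτ h t ht q
    exact HamiltonJacobi.eq_of_eq_at hH hu hv hτ ht (funext h) q
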